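/- Let $L,\rho,\Lambda,m,J>0$ and let $k_1,k_2\in C^2(\mathbb R)$ satisfy $\int_0^z k_1(s)\,ds\ge 0$ and $k_2'(z)\ge 0$ for all $z\in\mathbb R$, $k_2(0)=0$, and $|k_2(z)|\ge Kz^2$ for all $z\in(-\delta,\delta)$, for some constants $K,\delta>0$. For $n\ge 2$ let $\tilde H^n_0(0,L)=\{f\in H^n(0,L): f(0)=f'(0)=0\}$ (real-valued functions), and let $\mathcal H$ be the real Hilbert space of all $y=[u,v,\xi,\psi]^\top$ with $u\in\tilde H^2_0(0,L)$, $v\in L^2(0,L)$, $\xi,\psi\in\mathbb R$, with inner product $$\langle y_1,y_2\rangle_{\mathcal H}=\frac\Lambda2\int_0^L u_1''u_2''\,dx+\frac\rho2\int_0^L v_1v_2\,dx+\frac1{2J}\xi_1\xi_2+\frac1{2m}\psi_1\psi_2 .$$ Let $A$ be the linear operator $$A[u,v,\xi,\psi]^\top=\Big[v,\,-\tfrac\Lambda\rho u'''',\,-\Lambda u''(L),\,\Lambda u'''(L)\Big]^\top,$$ $$D(A)=\{y\in\mathcal H: u\in\tilde H^4_0(0,L),\ v\in\tilde H^2_0(0,L),\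 \xi=Jv'(L),\ \psi=mv(L)\},$$ let $\mathcal N y=\big[0,0,0,-k_1(u(L))-k_2(\psi/m)\big]^\top$ for $y\in\mathcal H$, let $\mathcal A=A+\mathcal N$ with $D(\mathcal A)=D(A)$, and let $$V(y)=\frac\Lambda2\int_0^L(u'')^2\,dx+\frac\rho2\int_0^Lv^2\,dx+\frac1{2m}\psi^2+\frac1{2J}\xi^2+\int_0^{u(L)}k_1(s)\,ds .$$ Consider the initial value problem $y_t=\mathcal A y$, $y(0)=y_0$. For $0<T\le\infty$, a mild solution on $[0,T)$ is a function $y\in C([0,T);\mathcal H)$ with $y(t)=e^{tA}y_0+\int_0^te^{(t-s)A}\mathcal N y(s)\,ds$ for $0\le t<T$, where $(e^{tA})_{t\ge0}$ is the $C_0$-semigroup on $\mathcal H$ generated by $A$. A classical solution on $[0,T)$ is a function $y\in C^1((0,T);\mathcal H)\cap C([0,T);\mathcal H)$ with $y(0)=y_0$ such that $y(t)\in D(\mathcal A)$ and $y_t(t)=\mathcal A y(t)$ for all $t\in(0,T)$. Then $A$ generates a $C_0$-semigroup on $\mathcal H$, and for every $y_0\in\mathcal H$ the initial value problem has a unique global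 mild solution $y:[0,\infty)\to\mathcal H$; every mild solution on an interval $[0,T)$, $0<T\le\infty$, is the restriction of $y$. If $y_0\in D(\mathcal A)$, then $y$ is a classical solution on $[0,\infty)$. Moreover, the function $t\mapsto V(y(t))$ is non-increasing on $[0,\infty)$, and $\|y(t)\|_{\mathcal H}$ is uniformly bounded on $[0,\infty)$. -/

import Mathlib

open Set Filter Topology MeasureTheory
open scoped ContDiff

namespace Beam

/-- The real space `L²(0, L)`. -/
abbrev L2 (L : ℝ) : Type := Lp ℝ 2 (volume.restrict (Ioo (0 : ℝ) L))

/-- Test functions `φ ∈ C_c^∞(0, L)`. -/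
structure IsTestFun (L : ℝ) (φ : ℝ → ℝ) : Prop where
  smooth : ContDiff ℝ ∞ φ
  compact : HasCompactSupport φ
  supp : tsupport φ ⊆ Ioo 0 L

/-- `g` is the weak derivative of `f` on `(0, L)`. -/
def HasWeakDeriv {L : ℝ} (f g : L2 L) : Prop :=
  ∀ φ : ℝ → ℝ, IsTestFun L φ →
    ∫ x in Ioo 0 L, f x * deriv φ x = -∫ x in Ioo 0 L, g x * φ x

theorem memLp_of_cont {L : ℝ} {φ : ℝ → ℝ} (h : ContinuousOn φ (Icc 0 L)) :
    MemLp φ 2 (volume.restrict (Ioo (0 : ℝ) L)) := by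
  obtain ⟨C, hC⟩ := isCompact_Icc.exists_bound_of_continuousOn h
  refine MemLp.of_bound ((h.mono Ioo_subset_Icc_self).aestronglyMeasurable measurableSet_Ioo) C ?_
  filter_upwards [ae_restrict_mem measurableSet_Ioo] with x hx
  exact hC x (Ioo_subset_Icc_self hx)

theorem integrable_mul_cont {L : ℝ} (f : L2 L) {φ : ℝ → ℝ} (h : Continuous φ) :
    Integrable (fun x => f x * φ x) (volume.restrict (Ioo (0 : ℝ) L)) :=
  (Lp.memLp f).integrable_mul (memLp_of_cont h.continuousOn)

theorem integrable_L2 {L : ℝ} (f : L2 L) :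
    Integrable (fun x => f x) (volume.restrict (Ioo (0 : ℝ) L)) :=
  (Lp.memLp f).integrable (by norm_num)

theorem intervalIntegrable_L2 {L : ℝ} (hL : 0 < L) (f : L2 L) :
    IntervalIntegrable (fun x => f x) volume 0 L := by
  rw [intervalIntegrable_iff_integrableOn_Ioo_of_le hL.le]
  exact integrable_L2 f

theorem IsTestFun.cont_deriv {L : ℝ} {φ : ℝ → ℝ} (h : IsTestFun L φ) : Continuous (deriv φ) :=
  h.smooth.continuous_deriv (by norm_cast)

theorem HasWeakDeriv.add {L : ℝ} {f g f' g' : L2 L} (h : HasWeakDeriv f g)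
    (h' : HasWeakDeriv f' g') : HasWeakDeriv (f + f') (g + g') := by
  intro φ hφ
  have e1 : ∫ x in Ioo 0 L, (f + f') x * deriv φ x
      = ∫ x in Ioo 0 L, (f x * deriv φ x + f' x * deriv φ x) := by
    refine integral_congr_ae ?_
    filter_upwards [Lp.coeFn_add f f'] with x hx
    rw [hx, Pi.add_apply, add_mul]
  have e2 : ∫ x in Ioo 0 L, (g + g') x * φ x
      = ∫ x in Ioo 0 L, (g x * φ x + g' x * φ x) := by
    refine integral_congr_ae ?_
    filter_upwards [Lp.coeFn_add g g'] with x hx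
    rw [hx, Pi.add_apply, add_mul]
  rw [e1, e2, integral_add (integrable_mul_cont f hφ.cont_deriv)
    (integrable_mul_cont f' hφ.cont_deriv), integral_add (integrable_mul_cont g hφ.smooth.continuous)
    (integrable_mul_cont g' hφ.smooth.continuous), h φ hφ, h' φ hφ]
  ring

theorem HasWeakDeriv.smul {L : ℝ} {f g : L2 L} (c : ℝ) (h : HasWeakDeriv f g) :
    HasWeakDeriv (c • f) (c • g) := by
  intro φ hφ
  have e1 : ∫ x in Ioo 0 L, (c • f) x * deriv φ x = ∫ x in Ioo 0 L, c * (f x * deriv φ x) := by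
    refine integral_congr_ae ?_
    filter_upwards [Lp.coeFn_smul c f] with x hx
    rw [hx, Pi.smul_apply, smul_eq_mul, mul_assoc]
  have e2 : ∫ x in Ioo 0 L, (c • g) x * φ x = ∫ x in Ioo 0 L, c * (g x * φ x) := by
    refine integral_congr_ae ?_
    filter_upwards [Lp.coeFn_smul c g] with x hx
    rw [hx, Pi.smul_apply, smul_eq_mul, mul_assoc]
  rw [e1, e2, integral_const_mul, integral_const_mul, h φ hφ]
  ring

theorem hasWeakDeriv_zero {L : ℝ} : HasWeakDeriv (0 : L2 L) 0 := by
  intro φ _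
  have hz : ∀ ψ : ℝ → ℝ, ∫ x in Ioo 0 L, (0 : L2 L) x * ψ x = 0 := fun ψ => by
    refine integral_eq_zero_of_ae ?_
    filter_upwards [Lp.coeFn_zero ℝ 2 (volume.restrict (Ioo (0 : ℝ) L))] with x hx
    rw [hx]; simp
  rw [hz, hz, neg_zero]

/-- The fundamental lemma of the calculus of variations on `(0, L)`. -/
theorem L2_eq_of_test {L : ℝ} {f g : L2 L}
    (h : ∀ φ, IsTestFun L φ → ∫ x in Ioo 0 L, f x * φ x = ∫ x in Ioo 0 L, g x * φ x) : f = g := by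
  have key := isOpen_Ioo.ae_eq_zero_of_integral_contDiff_smul_eq_zero (μ := volume)
    (U := Ioo (0 : ℝ) L) (f := fun x => f x - g x)
    (IntegrableOn.locallyIntegrableOn ((integrable_L2 f).sub (integrable_L2 g))) (by
      intro φ h1 h2 h3
      have hφ : IsTestFun L φ := ⟨h1, h2, h3⟩
      have e := integral_sub (integrable_mul_cont f h1.continuous)
        (integrable_mul_cont g h1.continuous)
      rw [h φ hφ, sub_self] at e
      rw [← setIntegral_eq_integral_of_forall_compl_eq_zero (s := Ioo 0 L)]
      · refine Eq.trans ?_ e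
        refine integral_congr_ae (Eventually.of_forall fun x => ?_)
        simp only [smul_eq_mul]; ring
      · intro x hx
        rw [image_eq_zero_of_notMem_tsupport (fun h' => hx (h3 h')), zero_smul])
  refine Lp.ext ?_
  rw [EventuallyEq, ae_restrict_iff' measurableSet_Ioo]
  filter_upwards [key] with x hx hx'
  exact sub_eq_zero.1 (hx hx')

theorem HasWeakDeriv.unique {L : ℝ} {f g g' : L2 L} (h : HasWeakDeriv f g)
    (h' : HasWeakDeriv f g') : g = g' :=
  L2_eq_of_test fun φ hφ => neg_injective ((h φ hφ).symm.trans (h' φ hφ))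

/-- The primitive `x ↦ ∫₀ˣ g`. -/
noncomputable def primFun {L : ℝ} (g : L2 L) (x : ℝ) : ℝ := ∫ t in (0 : ℝ)..x, g t

theorem primFun_ac {L : ℝ} (hL : 0 < L) (g : L2 L) :
    AbsolutelyContinuousOnInterval (primFun g) 0 L :=
  (intervalIntegrable_L2 hL g).absolutelyContinuousOnInterval_intervalIntegral (by simp)

theorem primFun_continuousOn {L : ℝ} (hL : 0 < L) (g : L2 L) :
    ContinuousOn (primFun g) (Icc 0 L) := by
  simpa [uIcc_of_le hL.le] using (primFun_ac hL g).continuousOn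

theorem primFun_byParts {L : ℝ} (hL : 0 < L) (g : L2 L) {φ : ℝ → ℝ} (hφ : IsTestFun L φ) :
    ∫ x in Ioo 0 L, primFun g x * deriv φ x = -∫ x in Ioo 0 L, g x * φ x := by
  have hφac : AbsolutelyContinuousOnInterval φ 0 L :=
    ContDiffOn.absolutelyContinuousOnInterval (hφ.smooth.of_le (by norm_cast)).contDiffOn
  have := (primFun_ac hL g).integral_mul_deriv_eq_deriv_mul hφac
  have h0 : φ 0 = 0 := image_eq_zero_of_notMem_tsupport fun h => lt_irrefl _ (hφ.supp h).1
  have hl : φ L = 0 := image_eq_zero_of_notMem_tsupport fun h => lt_irrefl _ (hφ.supp h).2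
  rw [h0, hl, mul_zero, mul_zero, sub_zero, zero_sub] at this
  rw [← integral_Ioc_eq_integral_Ioo, ← integral_Ioc_eq_integral_Ioo,
    ← intervalIntegral.integral_of_le hL.le, ← intervalIntegral.integral_of_le hL.le, this]
  congr 1
  refine intervalIntegral.integral_congr_ae ?_
  filter_upwards [(intervalIntegrable_L2 hL g).ae_hasDerivAt_integral] with x hx hx'
  have : HasDerivAt (primFun g) (g x) x := hx (uIoc_subset_uIcc hx') 0 (by simp)
  rw [this.deriv]

/-- The primitive `x ↦ c + ∫₀ˣ g` as an element of `L²(0, L)`. -/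
noncomputable def prim {L : ℝ} (hL : 0 < L) (c : ℝ) (g : L2 L) : L2 L :=
  (memLp_of_cont (continuousOn_const.add (primFun_continuousOn hL g)) :
    MemLp (fun x => c + primFun g x) 2 _).toLp _

theorem prim_coe {L : ℝ} (hL : 0 < L) (c : ℝ) (g : L2 L) :
    prim hL c g =ᵐ[volume.restrict (Ioo (0 : ℝ) L)] fun x => c + primFun g x :=
  MemLp.coeFn_toLp _

theorem IsTestFun.integral_deriv {L : ℝ} (hL : 0 < L) {φ : ℝ → ℝ} (hφ : IsTestFun L φ) :
    ∫ x in Ioo 0 L, deriv φ x = 0 := by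
  have h0 : φ 0 = 0 := image_eq_zero_of_notMem_tsupport fun h => lt_irrefl _ (hφ.supp h).1
  have hl : φ L = 0 := image_eq_zero_of_notMem_tsupport fun h => lt_irrefl _ (hφ.supp h).2
  rw [← integral_Ioc_eq_integral_Ioo, ← intervalIntegral.integral_of_le hL.le,
    intervalIntegral.integral_deriv_eq_sub
      (fun x _ => (hφ.smooth.differentiable (by norm_cast)).differentiableAt)
      (hφ.cont_deriv.intervalIntegrable _ _), h0, hl, sub_zero]

theorem hasWeakDeriv_prim {L : ℝ} (hL : 0 < L) (c : ℝ) (g : L2 L) :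
    HasWeakDeriv (prim hL c g) g := by
  intro φ hφ
  rw [← primFun_byParts hL g hφ]
  have e : ∫ x in Ioo 0 L, prim hL c g x * deriv φ x
      = ∫ x in Ioo 0 L, (c * deriv φ x + primFun g x * deriv φ x) := by
    refine integral_congr_ae ?_
    filter_upwards [prim_coe hL c g] with x hx
    rw [hx, add_mul]
  rw [e, integral_add, integral_const_mul, hφ.integral_deriv hL, mul_zero, zero_add]
  · exact ((memLp_of_cont hφ.cont_deriv.continuousOn).integrable (by norm_num)).const_mul c
  · exact (memLp_of_cont (primFun_continuousOn hL g)).integrable_mul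
      (memLp_of_cont hφ.cont_deriv.continuousOn)


/-- A test function whose integral vanishes is the derivative of a test function. -/
theorem IsTestFun.exists_primitive {L : ℝ} (hL : 0 < L) {χ : ℝ → ℝ} (hχ : IsTestFun L χ)
    (h0 : ∫ x in Ioo 0 L, χ x = 0) : ∃ Φ, IsTestFun L Φ ∧ deriv Φ = χ := by
  obtain ⟨a, b, ha, hb, hab⟩ : ∃ a b : ℝ, 0 < a ∧ b < L ∧ tsupport χ ⊆ Icc a b := by
    rcases (tsupport χ).eq_empty_or_nonempty with he | hne
    · exact ⟨1, L - 1, one_pos, by linarith, by simp [he]⟩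
    · obtain ⟨a, ha, ha'⟩ := IsCompact.exists_isLeast hχ.compact hne
      obtain ⟨b, hb, hb'⟩ := IsCompact.exists_isGreatest hχ.compact hne
      exact ⟨a, b, (hχ.supp ha).1, (hχ.supp hb).2, fun x hx => ⟨ha' hx, hb' hx⟩⟩
  have hc : Continuous χ := hχ.smooth.continuous
  have hz : ∀ x, x ∉ Icc a b → χ x = 0 := fun x hx =>
    image_eq_zero_of_notMem_tsupport fun h => hx (hab h)
  have hd : ∀ x, HasDerivAt (fun x => ∫ t in (0 : ℝ)..x, χ t) (χ x) x := fun x =>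
    intervalIntegral.integral_hasDerivAt_right (hc.intervalIntegrable _ _)
      hc.stronglyMeasurable.stronglyMeasurableAtFilter hc.continuousAt
  have hdd : deriv (fun x => ∫ t in (0 : ℝ)..x, χ t) = χ := funext fun x => (hd x).deriv
  have hL0 : ∫ t in (0 : ℝ)..L, χ t = 0 := by
    rw [intervalIntegral.integral_of_le hL.le, integral_Ioc_eq_integral_Ioo, h0]
  have hsub : tsupport (fun x => ∫ t in (0 : ℝ)..x, χ t) ⊆ Icc a b := by
    refine closure_minimal (fun x hx => ?_) isClosed_Icc
    by_contra hxn
    refine hx ?_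
    rcases not_and_or.1 hxn with h | h
    · refine (intervalIntegral.integral_congr (g := fun _ => (0 : ℝ)) fun t ht => ?_).trans
        (by simp)
      refine hz t fun ht' => ?_
      rcases le_total 0 x with h' | h'
      · rw [uIcc_of_le h'] at ht; linarith [ht.2, ht'.1, not_le.1 h]
      · rw [uIcc_of_ge h'] at ht; linarith [ht.2, ht'.1]
    · have e : ∫ t in x..L, χ t = 0 := by
        refine (intervalIntegral.integral_congr (g := fun _ => (0 : ℝ)) fun t ht => ?_).trans
          (by simp)
        refine hz t fun ht' => ?_
        rcases le_total x L with h' | h'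
        · rw [uIcc_of_le h'] at ht; linarith [ht.1, ht'.2, not_le.1 h]
        · rw [uIcc_of_ge h'] at ht; linarith [ht.1, ht'.2]
      have := intervalIntegral.integral_add_adjacent_intervals
        (hc.intervalIntegrable (μ := volume) 0 x) (hc.intervalIntegrable (μ := volume) x L)
      rw [e, hL0, add_zero] at this
      exact this
  refine ⟨fun x => ∫ t in (0 : ℝ)..x, χ t, ⟨?_, ?_, ?_⟩, hdd⟩
  · rw [contDiff_infty_iff_deriv, hdd]
    exact ⟨fun x => (hd x).differentiableAt, hχ.smooth⟩
  · exact HasCompactSupport.of_support_subset_isCompact isCompact_Icc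
      ((subset_tsupport _).trans hsub)
  · exact hsub.trans fun x hx => ⟨ha.trans_le hx.1, hx.2.trans_lt hb⟩

theorem exists_testFun {L : ℝ} (hL : 0 < L) :
    ∃ θ, IsTestFun L θ ∧ ∫ x in Ioo 0 L, θ x = 1 := by
  let b : ContDiffBump (L / 2) := ⟨L / 8, L / 4, by linarith, by linarith⟩
  have hs : tsupport (b.normed volume) ⊆ Ioo 0 L := by
    rw [b.tsupport_normed_eq, Real.closedBall_eq_Icc]
    intro x hx
    have h1 := hx.1
    have h2 := hx.2
    change L / 2 - L / 4 ≤ x at h1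
    change x ≤ L / 2 + L / 4 at h2
    constructor <;> linarith
  refine ⟨b.normed volume, ⟨b.contDiff_normed, b.hasCompactSupport_normed, hs⟩, ?_⟩
  rw [setIntegral_eq_integral_of_forall_compl_eq_zero, b.integral_normed]
  intro x hx
  exact image_eq_zero_of_notMem_tsupport fun h' => hx (hs h')

theorem IsTestFun.sub_mul {L : ℝ} {φ θ : ℝ → ℝ} (hφ : IsTestFun L φ) (hθ : IsTestFun L θ) (c : ℝ) :
    IsTestFun L (fun x => φ x - c * θ x) := by
  have hsub : tsupport (fun x => φ x - c * θ x) ⊆ tsupport φ ∪ tsupport θ := by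
    refine closure_minimal (fun x hx => ?_)
      ((isClosed_tsupport _).union (isClosed_tsupport _))
    by_contra hn
    rw [mem_union, not_or] at hn
    refine hx ?_
    simp [image_eq_zero_of_notMem_tsupport hn.1, image_eq_zero_of_notMem_tsupport hn.2]
  refine ⟨hφ.smooth.sub (contDiff_const.mul hθ.smooth), ?_,
    hsub.trans (union_subset hφ.supp hθ.supp)⟩
  exact HasCompactSupport.of_support_subset_isCompact (IsCompact.union hφ.compact hθ.compact)
    ((subset_tsupport _).trans hsub)

theorem primFun_zero {L x : ℝ} (hx : x ∈ Ioo 0 L) : primFun (0 : L2 L) x = 0 := by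
  rw [primFun, intervalIntegral.integral_of_le hx.1.le]
  refine integral_eq_zero_of_ae ?_
  have h := Lp.coeFn_zero ℝ 2 (volume.restrict (Ioo (0 : ℝ) L))
  rw [EventuallyEq, ae_restrict_iff' measurableSet_Ioo] at h
  rw [EventuallyEq, ae_restrict_iff' measurableSet_Ioc]
  filter_upwards [h] with t ht ht'
  exact ht ⟨ht'.1, ht'.2.trans_lt hx.2⟩

/-- A function with vanishing weak derivative is constant. -/
theorem const_of_weakDeriv_zero {L : ℝ} (hL : 0 < L) {f : L2 L} (h : HasWeakDeriv f 0) :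
    ∃ c : ℝ, f = prim hL c 0 := by
  obtain ⟨θ, hθ, hθ1⟩ := exists_testFun hL
  refine ⟨∫ x in Ioo 0 L, f x * θ x, L2_eq_of_test fun φ hφ => ?_⟩
  set c := ∫ x in Ioo 0 L, f x * θ x with hc
  have iφ : Integrable φ (volume.restrict (Ioo (0 : ℝ) L)) :=
    (memLp_of_cont hφ.smooth.continuous.continuousOn).integrable (by norm_num)
  have iθ : Integrable θ (volume.restrict (Ioo (0 : ℝ) L)) :=
    (memLp_of_cont hθ.smooth.continuous.continuousOn).integrable (by norm_num)
  set d := ∫ x in Ioo 0 L, φ x with hd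
  obtain ⟨Φ, hΦ, hΦ'⟩ := (hφ.sub_mul hθ d).exists_primitive hL (by
    rw [integral_sub iφ (iθ.const_mul d), integral_const_mul, hθ1, mul_one, sub_self])
  have h1 := h Φ hΦ
  have hz : ∫ x in Ioo 0 L, (0 : L2 L) x * Φ x = 0 := by
    refine integral_eq_zero_of_ae ?_
    filter_upwards [Lp.coeFn_zero ℝ 2 (volume.restrict (Ioo (0 : ℝ) L))] with x hx
    rw [hx]; simp
  have h2 : ∫ x in Ioo 0 L, f x * deriv Φ x
      = ∫ x in Ioo 0 L, (f x * φ x - d * (f x * θ x)) := by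
    rw [hΦ']
    refine integral_congr_ae (Eventually.of_forall fun x => ?_)
    ring
  rw [hz, neg_zero, h2, integral_sub (integrable_mul_cont f hφ.smooth.continuous)
    ((integrable_mul_cont f hθ.smooth.continuous).const_mul d), integral_const_mul, ← hc,
    sub_eq_zero] at h1
  rw [h1]
  have h3 : ∫ x in Ioo 0 L, prim hL c 0 x * φ x = ∫ x in Ioo 0 L, c * φ x := by
    refine integral_congr_ae ?_
    filter_upwards [prim_coe hL c 0, ae_restrict_mem measurableSet_Ioo] with x hx hx'
    rw [hx, primFun_zero hx', add_zero]
  rw [h3, integral_const_mul, mul_comm]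

theorem HasWeakDeriv.eq_prim {L : ℝ} (hL : 0 < L) {f g : L2 L} (h : HasWeakDeriv f g) :
    ∃ c : ℝ, f = prim hL c g := by
  have h1 : HasWeakDeriv (f + (-1 : ℝ) • prim hL 0 g) (g + (-1 : ℝ) • g) :=
    h.add ((hasWeakDeriv_prim hL 0 g).smul (-1))
  rw [neg_one_smul, neg_one_smul, add_neg_cancel] at h1
  obtain ⟨c, hc⟩ := const_of_weakDeriv_zero hL h1
  refine ⟨c, ?_⟩
  rw [add_neg_eq_iff_eq_add] at hc
  refine Lp.ext ?_
  rw [hc]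
  filter_upwards [Lp.coeFn_add (prim hL c 0) (prim hL 0 g), prim_coe hL c 0, prim_coe hL 0 g,
    prim_coe hL c g, ae_restrict_mem measurableSet_Ioo] with x h1 h2 h3 h4 h5
  rw [h1, Pi.add_apply, h2, h3, h4, primFun_zero h5]
  ring

/-! ### Weak derivatives, Sobolev spaces and point values -/

/-- The Sobolev space `Hⁿ(0, L)`: `f ∈ L²(0, L)` whose weak derivatives up to order `n`
exist and lie in `L²(0, L)`. -/
def MemH {L : ℝ} : ℕ → L2 L → Prop
  | 0, _ => True
  | n + 1, f => ∃ g : L2 L, HasWeakDeriv f g ∧ MemH n g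

open Classical in
/-- The weak derivative `f'` of `f ∈ H¹(0, L)`; it is unique, see `HasWeakDeriv.unique`. -/
noncomputable def wderiv {L : ℝ} (f : L2 L) : L2 L :=
  if h : ∃ g, HasWeakDeriv f g then h.choose else 0

open Classical in
/-- The point value `f(x₀)`, `x₀ ∈ [0, L]`, of the continuous representative of `f` on `[0, L]`. -/
noncomputable def ptVal {L : ℝ} (x₀ : ℝ) (f : L2 L) : ℝ :=
  if h : ∃ c : ℝ → ℝ, ContinuousOn c (Icc 0 L) ∧ f =ᵐ[volume.restrict (Ioo (0 : ℝ) L)] c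
  then h.choose x₀ else 0

theorem HasWeakDeriv.wderiv_eq {L : ℝ} {f g : L2 L} (h : HasWeakDeriv f g) : wderiv f = g := by
  have h' : ∃ g, HasWeakDeriv f g := ⟨g, h⟩
  rw [wderiv, dif_pos h']
  exact h'.choose_spec.unique h

theorem MemH.hasWeakDeriv {L : ℝ} {n : ℕ} {f : L2 L} (h : MemH (n + 1) f) :
    HasWeakDeriv f (wderiv f) := by
  obtain ⟨g, hg, -⟩ := h
  rwa [hg.wderiv_eq]

theorem MemH.wderiv {L : ℝ} {n : ℕ} {f : L2 L} (h : MemH (n + 1) f) : MemH n (wderiv f) := by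
  obtain ⟨g, hg, hg'⟩ := h
  rwa [hg.wderiv_eq]

theorem MemH.of_succ {L : ℝ} {n : ℕ} : ∀ {f : L2 L}, MemH (n + 1) f → MemH n f := by
  induction n with
  | zero => intro _ _; trivial
  | succ n ih => rintro f ⟨g, hg, hg'⟩; exact ⟨g, hg, ih hg'⟩

theorem MemH.add {L : ℝ} {n : ℕ} : ∀ {f g : L2 L}, MemH n f → MemH n g → MemH n (f + g) := by
  induction n with
  | zero => intro _ _ _ _; trivial
  | succ n ih =>
    rintro f g ⟨f', h1, h2⟩ ⟨g', h3, h4⟩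
    exact ⟨f' + g', h1.add h3, ih h2 h4⟩

theorem MemH.smul {L : ℝ} {n : ℕ} (c : ℝ) : ∀ {f : L2 L}, MemH n f → MemH n (c • f) := by
  induction n with
  | zero => intro _ _; trivial
  | succ n ih =>
    rintro f ⟨f', h1, h2⟩
    exact ⟨c • f', h1.smul c, ih h2⟩

theorem memH_zero {L : ℝ} (n : ℕ) : MemH n (0 : L2 L) := by
  induction n with
  | zero => trivial
  | succ n ih => exact ⟨0, hasWeakDeriv_zero, ih⟩

theorem wderiv_zero {L : ℝ} : wderiv (0 : L2 L) = 0 := hasWeakDeriv_zero.wderiv_eq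

theorem wderiv_add {L : ℝ} {n : ℕ} {f g : L2 L} (hf : MemH (n + 1) f) (hg : MemH (n + 1) g) :
    wderiv (f + g) = wderiv f + wderiv g :=
  (hf.hasWeakDeriv.add hg.hasWeakDeriv).wderiv_eq

theorem wderiv_smul {L : ℝ} {n : ℕ} {f : L2 L} (c : ℝ) (hf : MemH (n + 1) f) :
    wderiv (c • f) = c • wderiv f :=
  (hf.hasWeakDeriv.smul c).wderiv_eq

/-- Any continuous representative computes the point values. -/
theorem ptVal_eq {L : ℝ} (hL : 0 < L) {f : L2 L} {c : ℝ → ℝ} (hc : ContinuousOn c (Icc 0 L))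
    (hf : f =ᵐ[volume.restrict (Ioo (0 : ℝ) L)] c) {x₀ : ℝ} (hx : x₀ ∈ Icc 0 L) :
    ptVal x₀ f = c x₀ := by
  have h : ∃ c : ℝ → ℝ, ContinuousOn c (Icc 0 L) ∧ f =ᵐ[volume.restrict (Ioo (0 : ℝ) L)] c :=
    ⟨c, hc, hf⟩
  rw [ptVal, dif_pos h]
  refine Measure.eqOn_Icc_of_ae_eq volume hL.ne ?_ h.choose_spec.1 hc hx
  rw [restrict_Ioo_eq_restrict_Icc.symm]
  exact h.choose_spec.2.symm.trans hf

theorem MemH.exists_cont {L : ℝ} (hL : 0 < L) {n : ℕ} {f : L2 L} (h : MemH (n + 1) f) :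
    ∃ c : ℝ → ℝ, ContinuousOn c (Icc 0 L) ∧ f =ᵐ[volume.restrict (Ioo (0 : ℝ) L)] c := by
  obtain ⟨c, hc⟩ := h.hasWeakDeriv.eq_prim hL
  refine ⟨fun x => c + primFun (Beam.wderiv f) x,
    continuousOn_const.add (primFun_continuousOn hL _), ?_⟩
  have h2 := prim_coe hL c (Beam.wderiv f)
  rwa [← hc] at h2

theorem ptVal_add {L : ℝ} (hL : 0 < L) {n : ℕ} {f g : L2 L} (hf : MemH (n + 1) f)
    (hg : MemH (n + 1) g) {x₀ : ℝ} (hx : x₀ ∈ Icc 0 L) :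
    ptVal x₀ (f + g) = ptVal x₀ f + ptVal x₀ g := by
  obtain ⟨c, hc, hc'⟩ := hf.exists_cont hL
  obtain ⟨d, hd, hd'⟩ := hg.exists_cont hL
  rw [ptVal_eq hL hc hc' hx, ptVal_eq hL hd hd' hx]
  exact ptVal_eq hL (hc.add hd) ((Lp.coeFn_add f g).trans (hc'.add hd')) hx

theorem ptVal_smul {L : ℝ} (hL : 0 < L) {n : ℕ} {f : L2 L} (r : ℝ) (hf : MemH (n + 1) f)
    {x₀ : ℝ} (hx : x₀ ∈ Icc 0 L) : ptVal x₀ (r • f) = r * ptVal x₀ f := by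
  obtain ⟨c, hc, hc'⟩ := hf.exists_cont hL
  rw [ptVal_eq hL hc hc' hx]
  refine ptVal_eq (c := fun x => r * c x) hL (continuousOn_const.mul hc) ?_ hx
  filter_upwards [Lp.coeFn_smul r f, hc'] with x h1 h2
  rw [h1, Pi.smul_apply, h2, smul_eq_mul]

theorem ptVal_zero {L : ℝ} (hL : 0 < L) {x₀ : ℝ} (hx : x₀ ∈ Icc 0 L) :
    ptVal x₀ (0 : L2 L) = 0 :=
  ptVal_eq (c := fun _ => 0) hL continuousOn_const (Lp.coeFn_zero _ _ _) hx

theorem ptVal_zero_prim {L : ℝ} (hL : 0 < L) (c : ℝ) (g : L2 L) : ptVal 0 (prim hL c g) = c := by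
  rw [ptVal_eq hL (continuousOn_const.add (primFun_continuousOn hL g)) (prim_coe hL c g)
    ⟨le_rfl, hL.le⟩]
  simp [primFun]

theorem eq_prim_of_ptVal {L : ℝ} (hL : 0 < L) {n : ℕ} {f : L2 L} (hf : MemH (n + 1) f) :
    f = prim hL (ptVal 0 f) (wderiv f) := by
  obtain ⟨c, hc⟩ := hf.hasWeakDeriv.eq_prim hL
  have : ptVal 0 f = c := by
    conv_lhs => rw [hc]
    exact ptVal_zero_prim hL c _
  rw [this]
  exact hc

/-- `H̃²₀(0, L) = {f ∈ H²(0, L) : f(0) = f'(0) = 0}`. -/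
noncomputable def H20 {L : ℝ} (hL : 0 < L) : Submodule ℝ (L2 L) where
  carrier := {f | MemH 2 f ∧ ptVal 0 f = 0 ∧ ptVal 0 (wderiv f) = 0}
  zero_mem' := ⟨memH_zero 2, ptVal_zero hL ⟨le_rfl, hL.le⟩, by
    rw [wderiv_zero]; exact ptVal_zero hL ⟨le_rfl, hL.le⟩⟩
  add_mem' := by
    rintro f g ⟨h1, h2, h3⟩ ⟨h1', h2', h3'⟩
    refine ⟨h1.add h1', ?_, ?_⟩
    · rw [ptVal_add hL h1 h1' ⟨le_rfl, hL.le⟩, h2, h2', add_zero]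
    · rw [wderiv_add h1 h1', ptVal_add hL h1.wderiv h1'.wderiv ⟨le_rfl, hL.le⟩, h3, h3', add_zero]
  smul_mem' := by
    rintro r f ⟨h1, h2, h3⟩
    refine ⟨h1.smul r, ?_, ?_⟩
    · rw [ptVal_smul hL r h1 ⟨le_rfl, hL.le⟩, h2, mul_zero]
    · rw [wderiv_smul r h1, ptVal_smul hL r h1.wderiv ⟨le_rfl, hL.le⟩, h3, mul_zero]

theorem memH_of_H20 {L : ℝ} {hL : 0 < L} (f : H20 hL) : MemH 2 (f : L2 L) := f.2.1

theorem eq_zero_of_H20 {L : ℝ} {hL : 0 < L} (f : H20 hL) (h : wderiv (wderiv (f : L2 L)) = 0) :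
    f = 0 := by
  have h1 := eq_prim_of_ptVal hL (memH_of_H20 f).wderiv
  rw [f.2.2.2, h] at h1
  have hz : prim hL 0 (0 : L2 L) = 0 := by
    refine Lp.ext ?_
    filter_upwards [prim_coe hL 0 0, Lp.coeFn_zero ℝ 2 (volume.restrict (Ioo (0 : ℝ) L)),
      ae_restrict_mem measurableSet_Ioo] with x h1 h2 h3
    rw [h1, h2, primFun_zero h3, add_zero]; rfl
  have h2 := eq_prim_of_ptVal hL (memH_of_H20 f)
  rw [f.2.2.1, h1, hz, hz] at h2
  exact Subtype.ext h2

theorem exists_H20 {L : ℝ} (hL : 0 < L) (g : L2 L) :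
    ∃ f : H20 hL, wderiv (wderiv (f : L2 L)) = g := by
  have h1 := hasWeakDeriv_prim hL 0 g
  have h2 := hasWeakDeriv_prim hL 0 (prim hL 0 g)
  refine ⟨⟨prim hL 0 (prim hL 0 g), ⟨⟨_, h2, _, h1, trivial⟩, ptVal_zero_prim hL _ _, ?_⟩⟩, ?_⟩
  · rw [h2.wderiv_eq]; exact ptVal_zero_prim hL _ _
  · change wderiv (wderiv (prim hL 0 (prim hL 0 g))) = g
    rw [h2.wderiv_eq, h1.wderiv_eq]

/-! ### The energy space, the operators and the energy -/

/-- The constants of the beam: length, mass per length, bending stiffness, tip mass and moment of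
inertia of the tip mass. -/
structure Params where
  L : ℝ
  ρ : ℝ
  Λ : ℝ
  m : ℝ
  J : ℝ
  L_pos : 0 < L
  ρ_pos : 0 < ρ
  Λ_pos : 0 < Λ
  m_pos : 0 < m
  J_pos : 0 < J

/-- The vector space `𝓗 = {[u, v, ξ, ψ] : u ∈ H̃²₀(0, L), v ∈ L²(0, L), ξ, ψ ∈ ℝ}`. -/
def StateSpace (p : Params) : Type := H20 p.L_pos × L2 p.L × ℝ × ℝ

noncomputable instance (p : Params) : AddCommGroup (StateSpace p) :=
  inferInstanceAs (AddCommGroup (H20 p.L_pos × L2 p.L × ℝ × ℝ))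

noncomputable instance (p : Params) : Module ℝ (StateSpace p) :=
  inferInstanceAs (Module ℝ (H20 p.L_pos × L2 p.L × ℝ × ℝ))

namespace StateSpace

variable {p : Params}

/-- The vector `[u, v, ξ, ψ]`. -/
def mk (u : H20 p.L_pos) (v : L2 p.L) (ξ ψ : ℝ) : StateSpace p := (u, v, ξ, ψ)

/-- The deflection `u`, as an element of `L²(0, L)`. -/
def u (y : StateSpace p) : L2 p.L := (y.1 : L2 p.L)

/-- The velocity `v`. -/
def v (y : StateSpace p) : L2 p.L := y.2.1

/-- The component `ξ`. -/
def ξ (y : StateSpace p) : ℝ := y.2.2.1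

/-- The component `ψ`. -/
def ψ (y : StateSpace p) : ℝ := y.2.2.2

theorem memH_u (y : StateSpace p) : MemH 2 y.u := y.1.2.1

theorem u_add (y z : StateSpace p) : (y + z).u = y.u + z.u := rfl
theorem v_add (y z : StateSpace p) : (y + z).v = y.v + z.v := rfl
theorem ξ_add (y z : StateSpace p) : (y + z).ξ = y.ξ + z.ξ := rfl
theorem ψ_add (y z : StateSpace p) : (y + z).ψ = y.ψ + z.ψ := rfl
theorem u_smul (r : ℝ) (y : StateSpace p) : (r • y).u = r • y.u := rfl
theorem v_smul (r : ℝ) (y : StateSpace p) : (r • y).v = r • y.v := rfl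
theorem ξ_smul (r : ℝ) (y : StateSpace p) : (r • y).ξ = r * y.ξ := rfl
theorem ψ_smul (r : ℝ) (y : StateSpace p) : (r • y).ψ = r * y.ψ := rfl

/-- The inner product `(Λ/2) ∫ D²u₁ D²u₂ + (ρ/2) ∫ v₁ v₂ + ξ₁ ξ₂ / (2 J) + ψ₁ ψ₂ / (2 m)`
of the energy space. -/
noncomputable def energyInner (y z : StateSpace p) : ℝ :=
  p.Λ / 2 * (∫ x in Ioo 0 p.L, wderiv (wderiv y.u) x * wderiv (wderiv z.u) x)
    + p.ρ / 2 * (∫ x in Ioo 0 p.L, y.v x * z.v x)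
    + 1 / (2 * p.J) * (y.ξ * z.ξ) + 1 / (2 * p.m) * (y.ψ * z.ψ)

theorem integral_mul_eq_inner {L : ℝ} (f g : L2 L) :
    ∫ x in Ioo 0 L, f x * g x = inner ℝ f g := by
  rw [L2.inner_def]
  refine integral_congr_ae (Eventually.of_forall fun x => ?_)
  simp [mul_comm]

/-- The second weak derivative of `u` as a linear map on the energy space. -/
noncomputable def D2 : StateSpace p →ₗ[ℝ] L2 p.L where
  toFun y := wderiv (wderiv y.u)
  map_add' y z := by
    rw [u_add, wderiv_add y.memH_u z.memH_u, wderiv_add y.memH_u.wderiv z.memH_u.wderiv]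
  map_smul' r y := by
    rw [u_smul, wderiv_smul r y.memH_u, wderiv_smul r y.memH_u.wderiv, RingHom.id_apply]

theorem energyInner_eq (y z : StateSpace p) : energyInner y z =
    p.Λ / 2 * inner ℝ (D2 y) (D2 z) + p.ρ / 2 * inner ℝ y.v z.v
    + 1 / (2 * p.J) * (y.ξ * z.ξ) + 1 / (2 * p.m) * (y.ψ * z.ψ) := by
  rw [energyInner, integral_mul_eq_inner, integral_mul_eq_inner]; rfl

theorem energyInner_self (y : StateSpace p) : energyInner y y =
    p.Λ / 2 * ‖D2 y‖ ^ 2 + p.ρ / 2 * ‖y.v‖ ^ 2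
    + 1 / (2 * p.J) * y.ξ ^ 2 + 1 / (2 * p.m) * y.ψ ^ 2 := by
  rw [energyInner_eq, real_inner_self_eq_norm_sq, real_inner_self_eq_norm_sq]; ring

/-- `energyInner` is an inner product. -/
@[reducible] noncomputable def core : InnerProductSpace.Core ℝ (StateSpace p) where
  inner := energyInner
  conj_inner_symm y z := by
    change energyInner z y = energyInner y z
    rw [energyInner_eq, energyInner_eq, real_inner_comm (D2 y), real_inner_comm y.v]
    ring
  re_inner_nonneg y := by
    have h1 := p.Λ_pos
    have h2 := p.ρ_pos
    have h3 := p.J_pos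
    have h4 := p.m_pos
    change 0 ≤ energyInner y y
    rw [energyInner_self]
    positivity
  add_left y z w := by
    simp only [energyInner_eq, map_add, v_add, ξ_add, ψ_add, inner_add_left]
    ring
  smul_left y z r := by
    simp only [energyInner_eq, map_smul, v_smul, ξ_smul, ψ_smul, real_inner_smul_left,
      conj_trivial]
    ring
  definite y h := by
    have h1 := p.Λ_pos
    have h2 := p.ρ_pos
    have h3 := p.J_pos
    have h4 := p.m_pos
    change energyInner y y = 0 at h
    rw [energyInner_self] at h
    have e1 : 0 ≤ p.Λ / 2 * ‖D2 y‖ ^ 2 := by positivity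
    have e2 : 0 ≤ p.ρ / 2 * ‖y.v‖ ^ 2 := by positivity
    have e3 : 0 ≤ 1 / (2 * p.J) * y.ξ ^ 2 := by positivity
    have e4 : 0 ≤ 1 / (2 * p.m) * y.ψ ^ 2 := by positivity
    have f1 : p.Λ / 2 * ‖D2 y‖ ^ 2 = 0 := by linarith
    have f2 : p.ρ / 2 * ‖y.v‖ ^ 2 = 0 := by linarith
    have f3 : 1 / (2 * p.J) * y.ξ ^ 2 = 0 := by linarith
    have f4 : 1 / (2 * p.m) * y.ψ ^ 2 = 0 := by linarith
    have g1 : D2 y = 0 := by simpa [h1.ne'] using f1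
    have g2 : y.v = 0 := by simpa [h2.ne'] using f2
    have g3 : y.ξ = 0 := by simpa [h3.ne'] using f3
    have g4 : y.ψ = 0 := by simpa [h4.ne'] using f4
    exact Prod.ext (eq_zero_of_H20 y.1 g1) (Prod.ext g2 (Prod.ext g3 g4))

noncomputable instance : NormedAddCommGroup (StateSpace p) :=
  InnerProductSpace.Core.toNormedAddCommGroup (cd := core)

noncomputable instance : InnerProductSpace ℝ (StateSpace p) :=
  InnerProductSpace.ofCore core.toCore

theorem inner_eq (y z : StateSpace p) : inner ℝ y z = energyInner y z := rfl

theorem norm_sq_eq (y : StateSpace p) : ‖y‖ ^ 2 =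
    p.Λ / 2 * ‖D2 y‖ ^ 2 + p.ρ / 2 * ‖y.v‖ ^ 2
    + 1 / (2 * p.J) * y.ξ ^ 2 + 1 / (2 * p.m) * y.ψ ^ 2 := by
  rw [← real_inner_self_eq_norm_sq, inner_eq]
  exact energyInner_self y

/-- Coordinates `[u, v, ξ, ψ] ↦ (D²u, v, ξ, ψ)`. -/
noncomputable def coords : StateSpace p →ₗ[ℝ] L2 p.L × L2 p.L × ℝ × ℝ where
  toFun y := (D2 y, y.v, y.ξ, y.ψ)
  map_add' y z := by rw [map_add]; rfl
  map_smul' r y := by rw [map_smul]; rfl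

theorem coords_surjective : Function.Surjective (coords (p := p)) := by
  rintro ⟨a, b, c, d⟩
  obtain ⟨f, hf⟩ := exists_H20 p.L_pos a
  exact ⟨mk f b c d, Prod.ext hf rfl⟩

/-- The energy space is a Hilbert space. -/
instance : CompleteSpace (StateSpace p) := by
  have h1 := p.Λ_pos
  have h2 := p.ρ_pos
  have h3 := p.J_pos
  have h4 := p.m_pos
  obtain ⟨c, hc, c1, c2, c3, c4⟩ : ∃ c : ℝ, 0 < c ∧ c ≤ p.Λ / 2 ∧ c ≤ p.ρ / 2 ∧
      c ≤ 1 / (2 * p.J) ∧ c ≤ 1 / (2 * p.m) :=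
    ⟨min (min (p.Λ / 2) (p.ρ / 2)) (min (1 / (2 * p.J)) (1 / (2 * p.m))), by positivity,
      (min_le_left _ _).trans (min_le_left _ _), (min_le_left _ _).trans (min_le_right _ _),
      (min_le_right _ _).trans (min_le_left _ _), (min_le_right _ _).trans (min_le_right _ _)⟩
  set M : ℝ := p.Λ / 2 + p.ρ / 2 + 1 / (2 * p.J) + 1 / (2 * p.m) with hM
  have hM0 : 0 ≤ M := by positivity
  have up : ∀ y : StateSpace p, ‖y‖ ≤ √M * ‖coords y‖ := fun y => by
    have n1 : ‖D2 y‖ ≤ ‖coords y‖ := norm_fst_le (coords y)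
    have n2' : ‖(coords y).2‖ ≤ ‖coords y‖ := norm_snd_le (coords y)
    have n2 : ‖y.v‖ ≤ ‖coords y‖ := (norm_fst_le (coords y).2).trans n2'
    have n3' : ‖(coords y).2.2‖ ≤ ‖coords y‖ := (norm_snd_le (coords y).2).trans n2'
    have n3 : |y.ξ| ≤ ‖coords y‖ := (norm_fst_le (coords y).2.2).trans n3'
    have n4 : |y.ψ| ≤ ‖coords y‖ := (norm_snd_le (coords y).2.2).trans n3'
    have s1 := pow_le_pow_left₀ (norm_nonneg _) n1 2
    have s2 := pow_le_pow_left₀ (norm_nonneg _) n2 2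
    have s3 := pow_le_pow_left₀ (abs_nonneg _) n3 2
    have s4 := pow_le_pow_left₀ (abs_nonneg _) n4 2
    rw [sq_abs] at s3 s4
    refine (sq_le_sq₀ (norm_nonneg _) (by positivity)).1 ?_
    rw [norm_sq_eq, mul_pow, Real.sq_sqrt hM0, hM, add_mul, add_mul, add_mul]
    gcongr
  have dn : ∀ y : StateSpace p, ‖coords y‖ ≤ √(1 / c) * ‖y‖ := fun y => by
    have key : ∀ a : ℝ, 0 ≤ a → c * a ^ 2 ≤ ‖y‖ ^ 2 → a ≤ √(1 / c) * ‖y‖ := fun a ha0 ha => by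
      refine (sq_le_sq₀ ha0 (by positivity)).1 ?_
      rw [mul_pow, Real.sq_sqrt (by positivity), one_div, ← div_eq_inv_mul, le_div_iff₀ hc]
      linarith
    have e1 : c * ‖D2 y‖ ^ 2 ≤ p.Λ / 2 * ‖D2 y‖ ^ 2 := by gcongr
    have e2 : c * ‖y.v‖ ^ 2 ≤ p.ρ / 2 * ‖y.v‖ ^ 2 := by gcongr
    have e3 : c * y.ξ ^ 2 ≤ 1 / (2 * p.J) * y.ξ ^ 2 := by gcongr
    have e4 : c * y.ψ ^ 2 ≤ 1 / (2 * p.m) * y.ψ ^ 2 := by gcongr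
    have p1 : 0 ≤ c * ‖D2 y‖ ^ 2 := by positivity
    have p2 : 0 ≤ c * ‖y.v‖ ^ 2 := by positivity
    have p3 : 0 ≤ c * y.ξ ^ 2 := by positivity
    have p4 : 0 ≤ c * y.ψ ^ 2 := by positivity
    have hn := norm_sq_eq y
    refine norm_prod_le_iff.2 ⟨key _ (norm_nonneg _) ?_, norm_prod_le_iff.2
      ⟨key _ (norm_nonneg _) ?_, norm_prod_le_iff.2 ⟨key _ (norm_nonneg _) ?_,
        key _ (norm_nonneg _) ?_⟩⟩⟩
    · change c * ‖D2 y‖ ^ 2 ≤ _; linarith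
    · change c * ‖y.v‖ ^ 2 ≤ _; linarith
    · change c * |y.ξ| ^ 2 ≤ _; rw [sq_abs]; linarith
    · change c * |y.ψ| ^ 2 ≤ _; rw [sq_abs]; linarith
  have hA : AntilipschitzWith (Real.toNNReal √M) (coords (p := p)) :=
    AddMonoidHomClass.antilipschitz_of_bound _ fun y => by
      rw [Real.coe_toNNReal _ (Real.sqrt_nonneg _)]; exact up y
  have hU : UniformContinuous (coords (p := p)) :=
    AddMonoidHomClass.uniformContinuous_of_bound _ _ dn
  exact ((hA.isUniformInducing hU).completeSpace_congr coords_surjective).2 inferInstance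

end StateSpace

open StateSpace in
/-- The domain `D(A)`: all `[u, v, ξ, ψ]` with `u ∈ H̃⁴₀(0, L)`, `v ∈ H̃²₀(0, L)`,
`ξ = J Dv(L)`, `ψ = m v(L)`. Note that `H̃⁴₀(0, L) = H̃²₀(0, L) ∩ H⁴(0, L)`. -/
noncomputable def domA (p : Params) : Submodule ℝ (StateSpace p) where
  carrier := {y | MemH 4 y.u ∧ y.v ∈ H20 p.L_pos ∧
    y.ξ = p.J * ptVal p.L (wderiv y.v) ∧ y.ψ = p.m * ptVal p.L y.v}
  zero_mem' := by
    have hL : p.L ∈ Icc 0 p.L := ⟨p.L_pos.le, le_rfl⟩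
    refine ⟨memH_zero 4, (H20 p.L_pos).zero_mem, ?_, ?_⟩
    · change (0 : ℝ) = p.J * ptVal p.L (wderiv (0 : L2 p.L))
      rw [wderiv_zero, ptVal_zero p.L_pos hL, mul_zero]
    · change (0 : ℝ) = p.m * ptVal p.L (0 : L2 p.L)
      rw [ptVal_zero p.L_pos hL, mul_zero]
  add_mem' := by
    rintro y z ⟨h1, h2, h3, h4⟩ ⟨h1', h2', h3', h4'⟩
    have hL : p.L ∈ Icc 0 p.L := ⟨p.L_pos.le, le_rfl⟩
    refine ⟨h1.add h1', (H20 p.L_pos).add_mem h2 h2', ?_, ?_⟩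
    · rw [ξ_add, v_add, wderiv_add h2.1 h2'.1, ptVal_add p.L_pos h2.1.wderiv h2'.1.wderiv hL,
        h3, h3']
      ring
    · rw [ψ_add, v_add, ptVal_add p.L_pos h2.1 h2'.1 hL, h4, h4']
      ring
  smul_mem' := by
    rintro r y ⟨h1, h2, h3, h4⟩
    have hL : p.L ∈ Icc 0 p.L := ⟨p.L_pos.le, le_rfl⟩
    refine ⟨h1.smul r, (H20 p.L_pos).smul_mem r h2, ?_, ?_⟩
    · rw [ξ_smul, v_smul, wderiv_smul r h2.1, ptVal_smul p.L_pos r h2.1.wderiv hL, h3]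
      ring
    · rw [ψ_smul, v_smul, ptVal_smul p.L_pos r h2.1 hL, h4]
      ring

open StateSpace in
/-- The operator `A [u, v, ξ, ψ] = [v, -(Λ/ρ) D⁴u, -Λ D²u(L), Λ D³u(L)]` with domain `D(A)`. -/
noncomputable def opA (p : Params) : StateSpace p →ₗ.[ℝ] StateSpace p where
  domain := domA p
  toFun :=
    { toFun := fun y => StateSpace.mk ⟨y.1.v, y.2.2.1⟩
        (-(p.Λ / p.ρ) • wderiv (wderiv (wderiv (wderiv y.1.u))))
        (-p.Λ * ptVal p.L (wderiv (wderiv y.1.u)))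
        (p.Λ * ptVal p.L (wderiv (wderiv (wderiv y.1.u))))
      map_add' := by
        rintro ⟨y, h1, h2⟩ ⟨z, h1', h2'⟩
        have hL : p.L ∈ Icc 0 p.L := ⟨p.L_pos.le, le_rfl⟩
        have e1 := wderiv_add h1 h1'
        have e2 := wderiv_add h1.wderiv h1'.wderiv
        have e3 := wderiv_add h1.wderiv.wderiv h1'.wderiv.wderiv
        have e4 := wderiv_add h1.wderiv.wderiv.wderiv h1'.wderiv.wderiv.wderiv
        have t2 := ptVal_add p.L_pos h1.wderiv.wderiv h1'.wderiv.wderiv hL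
        have t3 := ptVal_add p.L_pos h1.wderiv.wderiv.wderiv h1'.wderiv.wderiv.wderiv hL
        refine Prod.ext rfl (Prod.ext ?_ (Prod.ext ?_ ?_))
        · change -(p.Λ / p.ρ) • wderiv (wderiv (wderiv (wderiv (y + z).u))) =
            -(p.Λ / p.ρ) • wderiv (wderiv (wderiv (wderiv y.u))) +
            -(p.Λ / p.ρ) • wderiv (wderiv (wderiv (wderiv z.u)))
          rw [u_add, e1, e2, e3, e4, smul_add]
        · change -p.Λ * ptVal p.L (wderiv (wderiv (y + z).u)) =
            -p.Λ * ptVal p.L (wderiv (wderiv y.u)) + -p.Λ * ptVal p.L (wderiv (wderiv z.u))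
          rw [u_add, e1, e2, t2, mul_add]
        · change p.Λ * ptVal p.L (wderiv (wderiv (wderiv (y + z).u))) =
            p.Λ * ptVal p.L (wderiv (wderiv (wderiv y.u))) +
            p.Λ * ptVal p.L (wderiv (wderiv (wderiv z.u)))
          rw [u_add, e1, e2, e3, t3, mul_add]
      map_smul' := by
        rintro r ⟨y, h1, h2⟩
        have hL : p.L ∈ Icc 0 p.L := ⟨p.L_pos.le, le_rfl⟩
        have e1 := wderiv_smul r h1
        have e2 := wderiv_smul r h1.wderiv
        have e3 := wderiv_smul r h1.wderiv.wderiv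
        have e4 := wderiv_smul r h1.wderiv.wderiv.wderiv
        have t2 := ptVal_smul p.L_pos r h1.wderiv.wderiv hL
        have t3 := ptVal_smul p.L_pos r h1.wderiv.wderiv.wderiv hL
        refine Prod.ext rfl (Prod.ext ?_ (Prod.ext ?_ ?_))
        · change -(p.Λ / p.ρ) • wderiv (wderiv (wderiv (wderiv (r • y).u))) =
            r • (-(p.Λ / p.ρ) • wderiv (wderiv (wderiv (wderiv y.u))))
          rw [u_smul, e1, e2, e3, e4, smul_comm]
        · change -p.Λ * ptVal p.L (wderiv (wderiv (r • y).u)) =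
            r * (-p.Λ * ptVal p.L (wderiv (wderiv y.u)))
          rw [u_smul, e1, e2, t2]
          ring
        · change p.Λ * ptVal p.L (wderiv (wderiv (wderiv (r • y).u))) =
            r * (p.Λ * ptVal p.L (wderiv (wderiv (wderiv y.u))))
          rw [u_smul, e1, e2, e3, t3]
          ring }

/-- The nonlinearity `𝓝 [u, v, ξ, ψ] = [0, 0, 0, -k₁(u(L)) - k₂(ψ / m)]`. -/
noncomputable def opN {p : Params} (k₁ k₂ : ℝ → ℝ) (y : StateSpace p) : StateSpace p :=
  StateSpace.mk 0 0 0 (-k₁ (ptVal p.L y.u) - k₂ (y.ψ / p.m))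

/-- The energy functional
`V(y) = (Λ/2) ∫ (D²u)² + (ρ/2) ∫ v² + ψ² / (2 m) + ξ² / (2 J) + ∫₀^{u(L)} k₁`. -/
noncomputable def energy {p : Params} (k₁ : ℝ → ℝ) (y : StateSpace p) : ℝ :=
  p.Λ / 2 * (∫ x in Ioo 0 p.L, wderiv (wderiv y.u) x ^ 2)
    + p.ρ / 2 * (∫ x in Ioo 0 p.L, y.v x ^ 2)
    + 1 / (2 * p.m) * y.ψ ^ 2 + 1 / (2 * p.J) * y.ξ ^ 2
    + ∫ s in (0 : ℝ)..ptVal p.L y.u, k₁ s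

/-! ### Semigroups and solutions -/

/-- `S t`, `t ≥ 0`, is a `C₀`-semigroup of bounded operators; the values at `t < 0` play no
role. -/
structure IsC0Semigroup {H : Type*} [NormedAddCommGroup H] [NormedSpace ℝ H]
    (S : ℝ → H →L[ℝ] H) : Prop where
  zero : S 0 = ContinuousLinearMap.id ℝ H
  add : ∀ s t : ℝ, 0 ≤ s → 0 ≤ t → S (s + t) = (S s).comp (S t)
  tendsto : ∀ x : H, Tendsto (fun t => S t x) (𝓝[>] 0) (𝓝 x)

/-- `A` generates the `C₀`-semigroup `S`, i.e. `S t = e^{tA}` for `t ≥ 0`: the domain of `A`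
consists of all `x` for which `(S t x - x) / t` converges as `t ↓ 0`, and `A x` is the limit. -/
structure Generates {H : Type*} [NormedAddCommGroup H] [NormedSpace ℝ H]
    (A : H →ₗ.[ℝ] H) (S : ℝ → H →L[ℝ] H) : Prop where
  isC0Semigroup : IsC0Semigroup S
  mem_graph_iff : ∀ x z : H,
    (x, z) ∈ A.graph ↔ Tendsto (fun t : ℝ => t⁻¹ • (S t x - x)) (𝓝[>] 0) (𝓝 z)

/-- `y` is a mild solution on `[0, T)`, `0 < T ≤ ∞`, of `y_t = (A + N) y`, `y(0) = y₀`, where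
`S t = e^{tA}`: it is continuous on `[0, T)` and satisfies Duhamel's formula. -/
structure IsMildSolution {H : Type*} [NormedAddCommGroup H] [NormedSpace ℝ H]
    (S : ℝ → H →L[ℝ] H) (N : H → H) (y₀ : H) (T : EReal) (y : ℝ → H) : Prop where
  continuousOn : ContinuousOn y {t : ℝ | 0 ≤ t ∧ (t : EReal) < T}
  duhamel : ∀ t : ℝ, 0 ≤ t → (t : EReal) < T →
    y t = S t y₀ + ∫ s in (0 : ℝ)..t, S (t - s) (N (y s))

/-- `y` is a classical solution on `[0, T)`, `0 < T ≤ ∞`, of `y_t = (A + N) y`, `y(0) = y₀`. -/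
structure IsClassicalSolution {H : Type*} [NormedAddCommGroup H] [NormedSpace ℝ H]
    (A : H →ₗ.[ℝ] H) (N : H → H) (y₀ : H) (T : EReal) (y : ℝ → H) : Prop where
  contDiffOn : ContDiffOn ℝ 1 y {t : ℝ | 0 < t ∧ (t : EReal) < T}
  continuousOn : ContinuousOn y {t : ℝ | 0 ≤ t ∧ (t : EReal) < T}
  initial : y 0 = y₀
  equation : ∀ t : ℝ, 0 < t → (t : EReal) < T →
    ∃ h : y t ∈ A.domain, deriv y t = A ⟨y t, h⟩ + N (y t)

end Beam

/-! In the energy inner product `A` is skew: two integrations by parts in ⟨Ay, y⟩ leave boundary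
terms at `L` that cancel against the ξ and ψ components, while those at 0 vanish by the clamping.
`A` is also onto, because `A y = z` is a fourth-order boundary value problem solved by successive
integration. Hence `A` has a bounded skew inverse `B` (`exists_skew_inverse`), and the abstract part
speaks of `B` only: D(A) is the range of `B`. From `B` one builds a group of isometries `U`
(`exists_skewGroup`); any semigroup generated by `A` agrees with it for t ≥ 0
(`IsSkewGroup.eq_of_generates`).

With e the unit vector in the ψ direction, 2⟨y, e⟩ = ψ/m and 2⟨By, e⟩ = u(L). So the nonlinearity is
the rank-one map y ↦ -(k₁(2⟨By, e⟩) + k₂(2⟨y, e⟩)) e, which is locally Lipschitz. The substitution y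
= U z turns the equation into z' = U(-t) N(U(t) z), an ordinary differential equation whose field
has the Lipschitz constants of N. Uniqueness is then a Gronwall argument.

The energy V = ‖y‖² + ∫₀^{2⟨By, e⟩} k₁ is differentiable even along mild solutions: ‖y‖ = ‖z‖, and
⟨By, e⟩ = -⟨y, Be⟩ pairs y with a vector of D(A). Its derivative is -(ψ/m) k₂(ψ/m) ≤ 0. Since the
potential is nonnegative, V bounds the norm; solving with truncated k₁, k₂ and showing that the
truncation is never felt gives global existence (`IsSkewGroup.exists_global_solution`).

For data in D(A) the orbit is Lipschitz in time, so the scalar feedback is absolutely continuous.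
Integrating by parts against U(-s) e puts y(t) into the range of `B` and yields a continuous
derivative (`IsSkewGroup.hasDerivAt_of_mem_range`). -/

namespace Beam

/-! ### The isometry group generated by the inverse of a bounded skew operator -/

section Group

variable {H : Type*} [NormedAddCommGroup H] [InnerProductSpace ℝ H]

/-- `U` is the strongly continuous group of isometries generated by `B⁻¹`. -/
structure IsSkewGroup (B : H →L[ℝ] H) (U : ℝ → H →L[ℝ] H) : Prop where
  zero : U 0 = ContinuousLinearMap.id ℝ H
  add_apply : ∀ s t x, U (s + t) x = U s (U t x)
  norm_apply : ∀ t x, ‖U t x‖ = ‖x‖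
  continuous : ∀ x, Continuous fun t => U t x
  comm : ∀ t x, U t (B x) = B (U t x)
  hasDerivAt : ∀ t x, HasDerivAt (fun t => U t (B x)) (U t x) t

/-- A skew-symmetric variant of the Yosida approximation of `B⁻¹`. -/
noncomputable def yosida (B : H →L[ℝ] H) (ε : ℝ) : H →L[ℝ] H :=
  -(B * Ring.inverse (ε ^ 2 • 1 - B * B))

theorem inner_shift_self {B : H →L[ℝ] H} (hB : ∀ x y, inner ℝ (B x) y = -inner ℝ x (B y))
    (ε : ℝ) (x : H) :
    inner ℝ ((ε ^ 2 • 1 - B * B : H →L[ℝ] H) x) x = ε ^ 2 * ‖x‖ ^ 2 + ‖B x‖ ^ 2 := by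
  have : (ε ^ 2 • 1 - B * B : H →L[ℝ] H) x = ε ^ 2 • x - B (B x) := by simp
  rw [this, inner_sub_left, real_inner_smul_left, hB, real_inner_self_eq_norm_sq,
    real_inner_self_eq_norm_sq]
  ring

theorem commute_inverse_shift {T B : H →L[ℝ] H} (h : Commute T B) (ε : ℝ) :
    Commute T (Ring.inverse (ε ^ 2 • 1 - B * B)) := by
  have h1 : Commute T (ε ^ 2 • 1 - B * B) :=
    ((Commute.one_right T).smul_right _).sub_right (h.mul_right h)
  by_cases hu : IsUnit (ε ^ 2 • 1 - B * B : H →L[ℝ] H)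
  · obtain ⟨u, hu⟩ := hu
    rw [← hu] at h1 ⊢
    rw [Ring.inverse_unit]
    exact h1.units_inv_right
  · rw [Ring.inverse_non_unit _ hu]; exact Commute.zero_right T

theorem commute_yosida {T B : H →L[ℝ] H} (h : Commute T B) (ε : ℝ) : Commute T (yosida B ε) :=
  (h.mul_right (commute_inverse_shift h ε)).neg_right

variable [CompleteSpace H]

theorem star_eq_neg_of_skew {B : H →L[ℝ] H} (hB : ∀ x y, inner ℝ (B x) y = -inner ℝ x (B y)) :
    star B = -B := by
  ext x
  refine ext_inner_right ℝ fun y => ?_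
  rw [ContinuousLinearMap.star_eq_adjoint, ContinuousLinearMap.adjoint_inner_left]
  simp [hB]

/-- Lax–Milgram: by skewness -B² is nonnegative, so the shift by ε² is coercive with constant ε². -/
theorem isUnit_shift {B : H →L[ℝ] H} (hB : ∀ x y, inner ℝ (B x) y = -inner ℝ x (B y))
    {ε : ℝ} (hε : 0 < ε) : IsUnit (ε ^ 2 • 1 - B * B : H →L[ℝ] H) := by
  refine ContinuousLinearMap.isUnit_of_forall_le_norm_inner_map _ (c := ⟨ε ^ 2, by positivity⟩)
    (by change (0 : ℝ) < ε ^ 2; positivity) fun x => ?_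
  rw [inner_shift_self hB, Real.norm_eq_abs, abs_of_nonneg (by positivity)]
  change ‖x‖ ^ 2 * ε ^ 2 ≤ _
  nlinarith [sq_nonneg ‖B x‖]

/-- The approximation is a product of a skew and a self-adjoint operator that commute. Its
exponentials are therefore isometries. -/
theorem star_yosida {B : H →L[ℝ] H} (hB : ∀ x y, inner ℝ (B x) y = -inner ℝ x (B y)) (ε : ℝ) :
    star (yosida B ε) = -yosida B ε := by
  have hs := star_eq_neg_of_skew hB
  have h2 : star (ε ^ 2 • 1 - B * B : H →L[ℝ] H) = ε ^ 2 • 1 - B * B := by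
    rw [star_sub, star_smul, star_one, star_mul, hs]; simp
  have h3 : star (Ring.inverse (ε ^ 2 • 1 - B * B : H →L[ℝ] H))
      = Ring.inverse (ε ^ 2 • 1 - B * B) := by
    rw [← Ring.inverse_star, h2]
  have h' := commute_inverse_shift (Commute.refl B) ε
  rw [yosida, star_neg, star_mul, h3, hs, mul_neg, h'.eq]

/-- A vector orthogonal to the range lies in the kernel, because the adjoint of B is -B. -/
theorem dense_range_of_skew {B : H →L[ℝ] H} (hB : ∀ x y, inner ℝ (B x) y = -inner ℝ x (B y))
    (hi : Function.Injective B) : DenseRange B := by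
  have : B.range.topologicalClosure = ⊤ := by
    rw [Submodule.topologicalClosure_eq_top_iff, Submodule.eq_bot_iff]
    intro x hx
    rw [Submodule.mem_orthogonal'] at hx
    apply hi
    rw [map_zero]
    refine ext_inner_right ℝ fun y => ?_
    have h0 : inner ℝ x (B y) = 0 := hx _ ⟨y, rfl⟩
    rw [hB, h0]; simp
  have h := (Submodule.dense_iff_topologicalClosure_eq_top (s := B.range)).2 this
  exact h

/-- With C = (ε² - B²)⁻¹ one has `yosida B ε (B x)` = x - ε² C x. The operators ε² C are
contractions, and on the dense range of B² they are O(ε²), so they tend strongly to 0. -/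
theorem yosida_apply_tendsto {B : H →L[ℝ] H} (hB : ∀ x y, inner ℝ (B x) y = -inner ℝ x (B y))
    (hi : Function.Injective B) (x : H) :
    Tendsto (fun n : ℕ => yosida B (1 / (n + 1 : ℝ)) (B x)) atTop (𝓝 x) := by
  set e : ℕ → ℝ := fun n => 1 / (n + 1 : ℝ) with he
  have epos : ∀ n, 0 < e n := fun n => by simp only [he]; positivity
  have elim : Tendsto e atTop (𝓝 0) := tendsto_one_div_add_atTop_nhds_zero_nat
  set C : ℕ → H →L[ℝ] H := fun n => Ring.inverse (e n ^ 2 • 1 - B * B) with hC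
  have hCl : ∀ n x, e n ^ 2 • C n x - C n (B (B x)) = x := fun n x => by
    have := Ring.inverse_mul_cancel _ (isUnit_shift hB (epos n))
    simpa using congrArg (fun T : H →L[ℝ] H => T x) this
  have hCr : ∀ n x, e n ^ 2 • C n x - B (B (C n x)) = x := fun n x => by
    have := Ring.mul_inverse_cancel _ (isUnit_shift hB (epos n))
    simpa using congrArg (fun T : H →L[ℝ] H => T x) this
  have bound : ∀ n x, e n ^ 2 * ‖C n x‖ ≤ ‖x‖ := fun n x => by
    have h1 := inner_shift_self hB (e n) (C n x)
    have h2 : (e n ^ 2 • 1 - B * B : H →L[ℝ] H) (C n x) = x := by simpa using hCr n x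
    rw [h2] at h1
    have h3 := real_inner_le_norm x (C n x)
    rcases (norm_nonneg (C n x)).eq_or_lt with h0 | h0
    · rw [← h0]; simp
    · refine le_of_mul_le_mul_right ?_ h0
      nlinarith [sq_nonneg ‖B (C n x)‖]
  have hyos : ∀ n x, yosida B (e n) (B x) = x - e n ^ 2 • C n x := fun n x => by
    have h1 : yosida B (e n) (B x) = B (yosida B (e n) x) :=
      (congrArg (fun T : H →L[ℝ] H => T x) (commute_yosida (Commute.refl B) (e n)).eq).symm
    have h2 : B (yosida B (e n) x) = -(B (B (C n x))) := by simp [yosida, hC]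
    rw [h1, h2]
    nth_rewrite 2 [← hCr n x]
    abel
  have small : ∀ w, Tendsto (fun n => e n ^ 2 • C n w) atTop (𝓝 0) := by
    intro w
    rw [Metric.tendsto_atTop]
    intro r hr
    have hd : Dense (Set.range fun x => B (B x)) :=
      (dense_range_of_skew hB hi).comp (dense_range_of_skew hB hi) B.continuous
    obtain ⟨_, hz, ⟨z, rfl⟩⟩ := Metric.dense_iff.1 hd w (r / 2) (by linarith)
    simp only [Metric.mem_ball] at hz
    have lim : Tendsto (fun n => e n ^ 2 * (2 * ‖z‖)) atTop (𝓝 0) := by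
      simpa using (elim.pow 2).mul_const (2 * ‖z‖)
    obtain ⟨N, hN⟩ := Metric.tendsto_atTop.1 lim (r / 2) (by linarith)
    refine ⟨N, fun n hn => ?_⟩
    have h1 := hN n hn
    rw [dist_zero_right, Real.norm_of_nonneg (by positivity)] at h1
    rw [dist_zero_right]
    have h2 : e n ^ 2 • C n w
        = e n ^ 2 • C n (w - B (B z)) + e n ^ 2 • (e n ^ 2 • C n z - z) := by
      -- This is C(ε² - B²)z = z solved for C B² z; by contractivity its norm is at most 2‖z‖.
      have : C n (B (B z)) = e n ^ 2 • C n z - z := by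
        nth_rewrite 3 [← hCl n z]; abel
      rw [map_sub, this]; module
    have h3 : ‖e n ^ 2 • C n (w - B (B z))‖ ≤ dist (B (B z)) w := by
      rw [norm_smul, Real.norm_of_nonneg (by positivity), dist_comm, dist_eq_norm]
      exact bound n _
    have h4 : ‖e n ^ 2 • (e n ^ 2 • C n z - z)‖ ≤ e n ^ 2 * (2 * ‖z‖) := by
      rw [norm_smul, Real.norm_of_nonneg (by positivity)]
      have h5 := norm_sub_le (e n ^ 2 • C n z) z
      have h6 := bound n z
      rw [norm_smul, Real.norm_of_nonneg (by positivity)] at h5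
      gcongr
      linarith
    rw [h2]
    have := norm_add_le (e n ^ 2 • C n (w - B (B z))) (e n ^ 2 • (e n ^ 2 • C n z - z))
    linarith
  have := (small x).const_sub x
  rw [sub_zero] at this
  exact this.congr fun n => (hyos n x).symm

open NormedSpace in
theorem norm_exp_apply {a : H →L[ℝ] H} (ha : star a = -a) (t : ℝ) (x : H) :
    ‖exp (t • a) x‖ = ‖x‖ := by
  have h : t • a ∈ skewAdjoint (H →L[ℝ] H) := by
    rw [skewAdjoint.mem_iff, star_smul, ha]; simp
  let _ : NormedAlgebra ℚ (H →L[ℝ] H) := NormedAlgebra.restrictScalars ℚ ℝ _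
  have hu := exp_mem_unitary_of_mem_skewAdjoint h
  exact ContinuousLinearMap.norm_map_of_mem_unitary hu x

open NormedSpace in
theorem hasDerivAt_exp_apply (a : H →L[ℝ] H) (t : ℝ) (x : H) :
    HasDerivAt (fun t : ℝ => exp (t • a) x) (exp (t • a) (a x)) t := by
  have h := hasDerivAt_exp_smul_const (𝕂 := ℝ) a t
  exact ((ContinuousLinearMap.apply ℝ H x).hasFDerivAt.comp_hasDerivAt t h)

open NormedSpace in
-- Commuting lets exp(tb) be factored out as an isometry. What remains is exp(t(a-b))x - x,
-- estimated by the mean value inequality.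
theorem norm_exp_sub_le {a b : H →L[ℝ] H} (ha : star a = -a) (hb : star b = -b)
    (hab : Commute a b) (t : ℝ) (x : H) :
    ‖exp (t • a) x - exp (t • b) x‖ ≤ |t| * ‖a x - b x‖ := by
  have hc : Commute (t • b) (t • (a - b)) :=
    ((hab.symm.sub_right (Commute.refl b)).smul_right t).smul_left t
  have h1 : exp (t • a) = exp (t • b) * exp (t • (a - b)) := by
    let _ : NormedAlgebra ℚ (H →L[ℝ] H) := NormedAlgebra.restrictScalars ℚ ℝ _
    rw [← exp_add_of_commute hc]; congr 1; module
  have hs : star (a - b) = -(a - b) := by rw [star_sub, ha, hb]; abel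
  have h2 : exp (t • a) x - exp (t • b) x = exp (t • b) (exp (t • (a - b)) x - x) := by
    rw [h1, map_sub]; rfl
  rw [h2, norm_exp_apply hb]
  have := Convex.norm_image_sub_le_of_norm_hasDerivWithin_le (s := univ) (x := (0 : ℝ)) (y := t)
    (f := fun t : ℝ => exp (t • (a - b)) x) (C := ‖a x - b x‖)
    (fun s _ => (hasDerivAt_exp_apply (a - b) s x).hasDerivWithinAt)
    (fun s _ => by rw [norm_exp_apply hs]; rfl) convex_univ trivial trivial
  simpa [mul_comm] using this

open NormedSpace in
-- A Stone-type theorem: U is the strong limit of the groups exp(t aₙ). On the range of B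
-- convergence follows from that of aₙBz and `norm_exp_sub_le`; density and isometry extend it to
-- all vectors.
theorem exists_skewGroup {B : H →L[ℝ] H} (hB : ∀ x y, inner ℝ (B x) y = -inner ℝ x (B y))
    (hi : Function.Injective B) : ∃ U, IsSkewGroup B U := by
  set a : ℕ → H →L[ℝ] H := fun n => yosida B (1 / (n + 1 : ℝ)) with ha
  have hstar : ∀ n, star (a n) = -a n := fun n => star_yosida hB _
  have hlim : ∀ x, Tendsto (fun n => a n (B x)) atTop (𝓝 x) := yosida_apply_tendsto hB hi
  have hcauchy : ∀ (t : ℝ) x, CauchySeq fun n => exp (t • a n) x := by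
    intro t x
    rw [Metric.cauchySeq_iff]
    intro r hr
    -- Replacing x by Bz costs at most r/4 under each of the two exponentials; the difference at Bz
    -- contributes at most r/4 more.
    obtain ⟨_, hz, ⟨z, rfl⟩⟩ := Metric.dense_iff.1 (dense_range_of_skew hB hi) x (r / 4)
      (by linarith)
    rw [Metric.mem_ball, dist_comm, dist_eq_norm] at hz
    obtain ⟨N, hN⟩ := Metric.cauchySeq_iff.1 (hlim z).cauchySeq (r / (4 * (|t| + 1)))
      (by positivity)
    refine ⟨N, fun m hm n hn => ?_⟩
    have h1 := hN m hm n hn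
    rw [dist_eq_norm, lt_div_iff₀ (by positivity)] at h1
    have h2 := norm_exp_sub_le (hstar m) (hstar n) (commute_yosida (commute_yosida (Commute.refl B) _).symm _) t (B z)
    have e : exp (t • a m) x - exp (t • a n) x = exp (t • a m) (x - B z)
        - exp (t • a n) (x - B z) + (exp (t • a m) (B z) - exp (t • a n) (B z)) := by
      simp only [map_sub]; abel
    rw [dist_eq_norm, e]
    have h3 := norm_add_le (exp (t • a m) (x - B z) - exp (t • a n) (x - B z))
      (exp (t • a m) (B z) - exp (t • a n) (B z))
    have h4 := norm_sub_le (exp (t • a m) (x - B z)) (exp (t • a n) (x - B z))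
    rw [norm_exp_apply (hstar m), norm_exp_apply (hstar n)] at h4
    have h5 := norm_nonneg (a m (B z) - a n (B z))
    have h6 := abs_nonneg t
    nlinarith
  choose f hf using fun t x => cauchySeq_tendsto_of_complete (hcauchy t x)
  set U : ℝ → H →L[ℝ] H := fun t =>
    continuousLinearMapOfTendsto (fun n => exp (t • a n)) (f := f t)
      (tendsto_pi_nhds.2 fun x => hf t x) with hU
  have hUt : ∀ t x, Tendsto (fun n => exp (t • a n) x) atTop (𝓝 (U t x)) := hf
  have hUseq : ∀ t (x : ℕ → H) y, Tendsto x atTop (𝓝 y) →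
      Tendsto (fun n => exp (t • a n) (x n)) atTop (𝓝 (U t y)) := by
    intro t x y hx
    have h1 : Tendsto (fun n => exp (t • a n) (x n - y)) atTop (𝓝 0) := by
      rw [tendsto_zero_iff_norm_tendsto_zero]
      simp only [norm_exp_apply (hstar _)]
      simpa using (hx.sub_const y).norm
    have := h1.add (hUt t y)
    simpa using this
  have hnorm : ∀ t x, ‖U t x‖ = ‖x‖ := fun t x => by
    refine tendsto_nhds_unique (hUt t x).norm ?_
    simp only [norm_exp_apply (hstar _)]
    exact tendsto_const_nhds
  have hadd : ∀ s t x, U (s + t) x = U s (U t x) := fun s t x => by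
    refine tendsto_nhds_unique (hUt (s + t) x) ?_
    refine (hUseq s _ _ (hUt t x)).congr fun n => ?_
    let _ : NormedAlgebra ℚ (H →L[ℝ] H) := NormedAlgebra.restrictScalars ℚ ℝ _
    rw [add_smul, exp_add_of_commute (((Commute.refl (a n)).smul_left s).smul_right t)]
    rfl
  -- On the range of B the orbits are Lipschitz with constant lim ‖aₙBx‖ = ‖x‖.
  have hcontB : ∀ x, Continuous fun t => U t (B x) := fun x => by
    refine (LipschitzWith.of_dist_le_mul (K := ‖x‖₊) fun s t => ?_).continuous
    refine le_of_tendsto_of_tendsto ((hUt s (B x)).dist (hUt t (B x)))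
      ((hlim x).norm.mul_const (dist s t)) (Eventually.of_forall fun n => ?_)
    have := Convex.norm_image_sub_le_of_norm_hasDerivWithin_le (s := univ) (x := t) (y := s)
      (f := fun t : ℝ => exp (t • a n) (B x)) (C := ‖a n (B x)‖)
      (fun s _ => (hasDerivAt_exp_apply (a n) s (B x)).hasDerivWithinAt)
      (fun s _ => by rw [norm_exp_apply (hstar n)]) convex_univ trivial trivial
    rw [← dist_eq_norm, ← dist_eq_norm] at this
    exact this
  have hcont : ∀ x, Continuous fun t => U t x := fun x => by
    obtain ⟨z, hz⟩ : ∃ z : ℕ → H, Tendsto (fun n => B (z n)) atTop (𝓝 x) := by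
      obtain ⟨w, hw, hw'⟩ := mem_closure_iff_seq_limit.1 (dense_range_of_skew hB hi x)
      choose z hz using hw
      exact ⟨z, by simpa only [hz] using hw'⟩
    have : TendstoUniformly (fun n t => U t (B (z n))) (fun t => U t x) atTop := by
      rw [Metric.tendstoUniformly_iff]
      intro r hr
      filter_upwards [Metric.tendsto_nhds.1 hz r hr] with n hn t
      rw [dist_eq_norm, ← map_sub, hnorm, ← dist_eq_norm, dist_comm]
      exact hn
    exact this.continuous (Eventually.of_forall fun n => hcontB (z n)).frequently
  -- Pass to the limit in the integrated equation for exp(t aₙ); the integrands are dominated by the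
  -- bounded sequence ‖aₙBx‖.
  have hint : ∀ t x, U t (B x) - B x = ∫ s in (0 : ℝ)..t, U s x := fun t x => by
    have e : ∀ n, ∫ s in (0 : ℝ)..t, exp (s • a n) (a n (B x)) = exp (t • a n) (B x) - B x :=
      fun n => by
        rw [intervalIntegral.integral_eq_sub_of_hasDerivAt
          (fun s _ => hasDerivAt_exp_apply (a n) s (B x))]
        · simp
        · exact Continuous.intervalIntegrable (continuous_iff_continuousAt.2 fun s =>
            (hasDerivAt_exp_apply (a n) s (a n (B x))).continuousAt) _ _
    refine tendsto_nhds_unique ((hUt t (B x)).sub_const (B x)) ?_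
    obtain ⟨M, hM⟩ := (hlim x).norm.bddAbove_range
    refine (intervalIntegral.tendsto_integral_filter_of_dominated_convergence
      (F := fun n s => exp (s • a n) (a n (B x))) (fun _ => M) ?_ ?_
      (intervalIntegrable_const) ?_).congr e
    · exact Eventually.of_forall fun n => (continuous_iff_continuousAt.2 fun s =>
            (hasDerivAt_exp_apply (a n) s (a n (B x))).continuousAt).aestronglyMeasurable
    · exact Eventually.of_forall fun n => Eventually.of_forall fun s _ => by
        rw [norm_exp_apply (hstar n)]; exact hM ⟨n, rfl⟩
    · exact Eventually.of_forall fun s _ => hUseq s _ _ (hlim x)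
  refine ⟨U, ?_, hadd, hnorm, hcont, fun t x => ?_, fun t x => ?_⟩
  · ext x
    refine tendsto_nhds_unique (hUt 0 x) ?_
    simp
  · refine tendsto_nhds_unique (hUt t (B x)) ((B.continuous.tendsto _).comp (hUt t x) |>.congr ?_)
    intro n
    have hc : Commute (exp (t • a n)) B :=
      ((commute_yosida (Commute.refl B) _).symm.smul_left t).exp_left
    exact (congrArg (fun T : H →L[ℝ] H => T x) hc.eq).symm
  · have h := (intervalIntegral.integral_hasDerivAt_right
      ((hcont x).intervalIntegrable 0 t) (hcont x).stronglyMeasurable.stronglyMeasurableAtFilter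
      (hcont x).continuousAt).add_const (B x)
    refine h.congr_of_eventuallyEq (Eventually.of_forall fun s => ?_)
    change U s (B x) = (∫ r in (0 : ℝ)..s, U r x) + B x
    rw [← hint]; abel

end Group

/-! ### Generation and uniqueness of the semigroup -/

section Generator

variable {H : Type*} [NormedAddCommGroup H] [InnerProductSpace ℝ H]
  {B : H →L[ℝ] H} {U : ℝ → H →L[ℝ] H}

theorem IsSkewGroup.neg_apply_apply (hU : IsSkewGroup B U) (t : ℝ) (x : H) :
    U (-t) (U t x) = x := by
  rw [← hU.add_apply, neg_add_cancel, hU.zero]; rfl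

theorem IsSkewGroup.apply_neg_apply (hU : IsSkewGroup B U) (t : ℝ) (x : H) :
    U t (U (-t) x) = x := by
  rw [← hU.add_apply, add_neg_cancel, hU.zero]; rfl

theorem IsSkewGroup.inner_apply_apply (hU : IsSkewGroup B U) (t : ℝ) (x y : H) :
    inner ℝ (U t x) (U t y) = inner ℝ x y :=
  LinearIsometry.inner_map_map ⟨(U t : H →ₗ[ℝ] H), hU.norm_apply t⟩ x y

theorem IsSkewGroup.inner_apply_left (hU : IsSkewGroup B U) (t : ℝ) (x y : H) :
    inner ℝ (U t x) y = inner ℝ x (U (-t) y) := by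
  rw [← hU.inner_apply_apply t x, hU.apply_neg_apply]

/-- Isometry upgrades strong continuity to joint continuity in time and vector. -/
theorem IsSkewGroup.tendsto (hU : IsSkewGroup B U) {ι : Type*} {l : Filter ι} {f : ι → ℝ}
    {y : ι → H} {t : ℝ} {x : H} (hf : Tendsto f l (𝓝 t)) (hy : Tendsto y l (𝓝 x)) :
    Tendsto (fun i => U (f i) (y i)) l (𝓝 (U t x)) := by
  have h1 : Tendsto (fun i => U (f i) (y i - x)) l (𝓝 0) := by
    rw [tendsto_zero_iff_norm_tendsto_zero]
    simp only [hU.norm_apply]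
    simpa using (hy.sub_const x).norm
  simpa using h1.add (((hU.continuous x).tendsto t).comp hf)

theorem IsSkewGroup.continuousOn (hU : IsSkewGroup B U) {s : Set ℝ} {f : ℝ → ℝ} {y : ℝ → H}
    (hf : ContinuousOn f s) (hy : ContinuousOn y s) :
    ContinuousOn (fun t => U (f t) (y t)) s :=
  fun t ht => hU.tendsto (hf t ht) (hy t ht)

theorem IsSkewGroup.hasDerivAt_neg (hU : IsSkewGroup B U) (t : ℝ) (x : H) :
    HasDerivAt (fun r => U (-r) (B x)) (-U (-t) x) t := by
  have h := (hU.hasDerivAt (-t) x).scomp t (_root_.hasDerivAt_neg t)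
  rwa [neg_one_smul] at h

/-- A product rule that needs only the single value y(t) in the range of B: the slope splits as
U(-r) applied to the slope of y, plus the slope of U(-·) y(t). -/
theorem IsSkewGroup.hasDerivWithinAt_neg (hU : IsSkewGroup B U) {s : Set ℝ} {y : ℝ → H}
    {y' z : H} {t : ℝ} (hy : HasDerivWithinAt y y' s t) (hz : y t = B z) :
    HasDerivWithinAt (fun r => U (-r) (y r)) (U (-t) (y' - z)) s t := by
  have h1 : HasDerivAt (fun r => U (-r) (y t)) (-U (-t) z) t := by
    rw [hz]
    exact hU.hasDerivAt_neg t z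
  have h2 := hasDerivWithinAt_iff_tendsto_slope.1 (h1.hasDerivWithinAt (s := s))
  have h3 := hasDerivWithinAt_iff_tendsto_slope.1 hy
  rw [hasDerivWithinAt_iff_tendsto_slope]
  have h4 : Tendsto (fun r : ℝ => -r) (𝓝[s \ {t}] t) (𝓝 (-t)) :=
    (continuous_neg.tendsto t).mono_left nhdsWithin_le_nhds
  have h5 := (hU.tendsto h4 h3).add h2
  rw [← sub_eq_add_neg, ← map_sub] at h5
  refine h5.congr fun r => ?_
  simp only [slope_def_module, map_smul, map_sub, ← smul_add]
  congr 1; abel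

theorem IsSkewGroup.generates (hU : IsSkewGroup B U) {A : H →ₗ.[ℝ] H}
    (hA : ∀ x z, (x, z) ∈ A.graph ↔ B z = x) : Generates A U := by
  have key : ∀ z, Tendsto (fun t : ℝ => t⁻¹ • (U t (B z) - B z)) (𝓝[>] 0) (𝓝 z) := fun z => by
    have h := (hasDerivAt_iff_tendsto_slope_zero.1 (hU.hasDerivAt 0 z)).mono_left
      (nhdsWithin_mono 0 (s := Ioi 0) fun t ht => (ne_of_gt ht))
    simpa [hU.zero] using h
  refine ⟨⟨hU.zero, fun s t _ _ => ?_, fun x => ?_⟩, fun x z => ?_⟩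
  · ext x; exact hU.add_apply s t x
  · have := ((hU.continuous x).tendsto 0).mono_left (nhdsWithin_le_nhds (s := Ioi 0))
    rwa [hU.zero] at this
  · rw [hA]
    -- For the converse, apply B to the difference quotient of x: it becomes the quotient of Bx,
    -- whose limit is x. Hence Bz = x.
    refine ⟨fun h => h ▸ key z, fun h => ?_⟩
    refine tendsto_nhds_unique ((B.continuous.tendsto z).comp h) ((key x).congr fun t => ?_)
    simp [hU.comm]

theorem IsC0Semigroup.add_apply {S : ℝ → H →L[ℝ] H} (hS : IsC0Semigroup S) {s t : ℝ}
    (hs : 0 ≤ s) (ht : 0 ≤ t) (x : H) : S (s + t) x = S s (S t x) := by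
  rw [hS.add s t hs ht]; rfl

/-- Otherwise ‖S tₙ‖ > n + 1 for some tₙ ↓ 0, while S tₙ x → x for every x, against
Banach–Steinhaus. -/
theorem IsC0Semigroup.exists_norm_le [CompleteSpace H] {S : ℝ → H →L[ℝ] H}
    (hS : IsC0Semigroup S) : ∃ δ > 0, ∃ M, ∀ t ∈ Icc (0 : ℝ) δ, ‖S t‖ ≤ M := by
  by_contra! hcon
  choose t ht ht' using fun n : ℕ => hcon (1 / (n + 1 : ℝ)) (by positivity) (n + 1)
  have hpos : ∀ n, 0 < t n := fun n => by
    refine (ht n).1.lt_of_ne fun h0 => ?_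
    have h1 := ht' n
    rw [← h0, hS.zero] at h1
    have h2 := ContinuousLinearMap.norm_id_le (𝕜 := ℝ) (E := H)
    have h3 : (0 : ℝ) ≤ n := n.cast_nonneg
    linarith
  have hlim : Tendsto t atTop (𝓝[>] 0) :=
    tendsto_nhdsWithin_iff.2 ⟨squeeze_zero (fun n => (ht n).1) (fun n => (ht n).2)
      tendsto_one_div_add_atTop_nhds_zero_nat, Eventually.of_forall hpos⟩
  obtain ⟨C, hC⟩ := banach_steinhaus (g := fun n => S (t n)) fun x => by
    obtain ⟨C, hC⟩ := ((hS.tendsto x).comp hlim).norm.bddAbove_range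
    exact ⟨C, fun n => hC ⟨n, rfl⟩⟩
  obtain ⟨n, hn⟩ := exists_nat_gt C
  have := hC n
  linarith [ht' n]

/-- The curve U(-s) S(s) Bz has zero right derivative, so it is constant. This gives equality near 0
on the dense range of B, and the semigroup law propagates it in steps of δ. Nothing is claimed for t
< 0, where S is arbitrary. -/
theorem IsSkewGroup.eq_of_generates [CompleteSpace H] (hU : IsSkewGroup B U)
    (hd : DenseRange B) {A : H →ₗ.[ℝ] H} (hA : ∀ x z, (x, z) ∈ A.graph ↔ B z = x)
    {S : ℝ → H →L[ℝ] H} (hS : Generates A S) {t : ℝ} (ht : 0 ≤ t) : S t = U t := by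
  have hS0 := hS.isC0Semigroup
  have gen : ∀ z, Tendsto (fun t : ℝ => t⁻¹ • (S t (B z) - B z)) (𝓝[>] 0) (𝓝 z) := fun z =>
    (hS.mem_graph_iff _ _).1 ((hA _ _).2 rfl)
  have comm : ∀ t z, 0 ≤ t → B (S t z) = S t (B z) := fun t z ht => by
    refine (hA _ _).1 ((hS.mem_graph_iff _ _).2 ?_)
    refine (((S t).continuous.tendsto z).comp (gen z)).congr' ?_
    filter_upwards [self_mem_nhdsWithin] with h hh
    have : S h (S t (B z)) = S t (S h (B z)) := by
      rw [← hS0.add_apply (le_of_lt hh) ht, ← hS0.add_apply ht (le_of_lt hh), add_comm]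
    simp [this]
  obtain ⟨δ, hδ, M, hM⟩ := hS0.exists_norm_le
  have hsmall : ∀ t ∈ Icc 0 δ, S t = U t := by
    have hM0 : 0 ≤ M := (norm_nonneg _).trans (hM 0 ⟨le_rfl, hδ.le⟩)
    -- The semigroup axioms give continuity only from the right at 0; writing the later value
    -- through the earlier time, the bound M gives continuity from both sides.
    have hcont : ∀ x, ContinuousOn (fun t => S t x) (Icc 0 δ) := fun x => by
      rw [Metric.continuousOn_iff]
      intro t ht r hr
      obtain ⟨η, hη, hη'⟩ := Metric.mem_nhdsWithin_iff.1 (Metric.tendsto_nhds.1 (hS0.tendsto x)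
        (r / (M + 1)) (by positivity))
      have key : ∀ a ∈ Icc 0 δ, ∀ b ∈ Icc 0 δ, a < b → dist b a < η →
          dist (S b x) (S a x) < r := fun a ha b hb hab hd => by
        have h1 : S b x = S a (S (b - a) x) := by
          rw [← hS0.add_apply ha.1 (by linarith), add_sub_cancel]
        have h2 : dist (S (b - a) x) x < r / (M + 1) := hη' ⟨by
          rw [Metric.mem_ball, Real.dist_eq, sub_zero, ← Real.dist_eq]; exact hd,
          show 0 < b - a by linarith⟩
        rw [h1, dist_eq_norm, ← map_sub]
        rw [dist_eq_norm, lt_div_iff₀ (by positivity)] at h2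
        have h3 := (S a).le_of_opNorm_le (hM a ha) (S (b - a) x - x)
        nlinarith [norm_nonneg (S (b - a) x - x)]
      refine ⟨η, hη, fun s hs hst => ?_⟩
      rcases lt_trichotomy s t with h | h | h
      · rw [dist_comm]; exact key s hs t ht h (by rwa [dist_comm])
      · rw [h, dist_self]; exact hr
      · exact key t ht s hs h hst
    intro t ht
    refine ContinuousLinearMap.ext fun x => ?_
    refine congrFun (hd.equalizer (S t).continuous (U t).continuous (funext fun z => ?_)) x
    have hg : ContinuousOn (fun s => U (-s) (S s (B z))) (Icc 0 δ) :=
      hU.continuousOn continuousOn_neg (hcont (B z))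
    have h := constant_of_has_deriv_right_zero hg (fun s hs => by
      have hder : HasDerivWithinAt (fun s => S s (B z)) (S s z) (Ici s) s := by
        rw [← hasDerivWithinAt_Ioi_iff_Ici, hasDerivWithinAt_iff_tendsto_slope' (by simp)]
        have hsub : Tendsto (fun r => r - s) (𝓝[>] s) (𝓝[>] 0) := by
          refine tendsto_nhdsWithin_iff.2 ⟨?_, ?_⟩
          · have : Tendsto (fun r => r - s) (𝓝 s) (𝓝 (s - s)) :=
              (continuous_sub_right s).tendsto s
            rw [sub_self] at this
            exact this.mono_left nhdsWithin_le_nhds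
          · filter_upwards [self_mem_nhdsWithin] with r hr
            exact sub_pos.2 (mem_Ioi.1 hr)
        refine (((S s).continuous.tendsto z).comp ((gen z).comp hsub)).congr' ?_
        filter_upwards [self_mem_nhdsWithin] with r hr
        have : S r (B z) = S s (S (r - s) (B z)) := by
          rw [← hS0.add_apply hs.1 (sub_nonneg.2 (le_of_lt hr)), add_sub_cancel]
        simp [slope_def_module, this]
      have := hU.hasDerivWithinAt_neg hder (comm s z hs.1).symm
      rwa [sub_self, map_zero] at this) t ht
    simp only [neg_zero, hU.zero, hS0.zero, ContinuousLinearMap.id_apply] at h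
    change S t (B z) = U t (B z)
    rw [← hU.apply_neg_apply t (S t (B z)), h]
  have hall : ∀ n : ℕ, ∀ t, 0 ≤ t → t ≤ n * δ → S t = U t := by
    intro n
    induction n with
    | zero => exact fun t h0 h1 => hsmall t ⟨h0, by simp at h1; linarith⟩
    | succ n ih =>
      intro t h0 h1
      rcases le_total t δ with h | h
      · exact hsmall t ⟨h0, h⟩
      · have h2 := hS0.add (t - δ) δ (by linarith) hδ.le
        rw [sub_add_cancel, ih (t - δ) (by linarith) (by push_cast at h1; linarith),
          hsmall δ ⟨hδ.le, le_rfl⟩] at h2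
        rw [h2]
        ext x
        rw [ContinuousLinearMap.comp_apply, ← hU.add_apply, sub_add_cancel]
  obtain ⟨n, hn⟩ := exists_nat_ge (t / δ)
  exact hall n t ht ((div_le_iff₀ hδ).1 hn)

end Generator

/-! ### Global integral curves and truncation of scalar functions -/

section Ode

variable {E : Type*} [NormedAddCommGroup E] [NormedSpace ℝ E] [CompleteSpace E]

/-- Bounded, globally Lipschitz vector fields have global integral curves. -/
theorem exists_global_integralCurve {v : ℝ → E → E} {K : NNReal} (hv : ∀ t, LipschitzWith K (v t))
    (hc : ∀ x, Continuous fun t => v t x) {M : ℝ} (hM : ∀ t x, ‖v t x‖ ≤ M) (x₀ : E) :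
    ∃ z : ℝ → E, z 0 = x₀ ∧ ∀ t, HasDerivAt z (v t (z t)) t := by
  have hM0 : 0 ≤ M := (norm_nonneg _).trans (hM 0 0)
  have loc : ∀ n : ℕ, ∃ z : ℝ → E, z 0 = x₀ ∧
      ∀ t ∈ Ioo (-(n + 1 : ℝ)) (n + 1), HasDerivAt z (v t (z t)) t := by
    intro n
    have hn : (0 : ℝ) < n + 1 := by positivity
    -- A field bounded by M moves a point by at most M(n+1) in time n+1, so this radius is
    -- admissible without smallness of the interval.
    have hp : IsPicardLindelof v (tmin := -(n + 1 : ℝ)) (tmax := n + 1)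
        ⟨0, by constructor <;> linarith⟩ x₀ ⟨M * (n + 1), by positivity⟩ 0 ⟨M, hM0⟩ K := by
      refine ⟨fun t _ => (hv t).lipschitzOnWith, fun x _ => (hc x).continuousOn,
        fun t _ x _ => hM t x, ?_⟩
      change M * max (n + 1 - 0 : ℝ) (0 - -(n + 1)) ≤ M * (n + 1) - 0
      simp
    obtain ⟨z, hz, hz'⟩ := hp.exists_eq_forall_mem_Icc_hasDerivWithinAt₀
    exact ⟨z, hz, fun t ht => (hz' t (Ioo_subset_Icc_self ht)).hasDerivAt (Icc_mem_nhds ht.1 ht.2)⟩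
  choose z hz0 hz using loc
  have agree : ∀ m n : ℕ, m ≤ n → EqOn (z m) (z n) (Ioo (-(m + 1 : ℝ)) (m + 1)) := by
    intro m n hmn
    have hmn' : (m : ℝ) ≤ n := by exact_mod_cast hmn
    have hm : (0 : ℝ) ≤ m := m.cast_nonneg
    refine ODE_solution_unique_of_mem_Ioo (s := fun _ => univ) (v := v) (t₀ := 0)
      (fun t _ => (hv t).lipschitzOnWith) (by constructor <;> linarith)
      (fun t ht => ⟨hz m t ht, trivial⟩)
      (fun t ht => ⟨hz n t ⟨by linarith [ht.1], by linarith [ht.2]⟩, trivial⟩) ?_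
    rw [hz0, hz0]
  have mem : ∀ t : ℝ, t ∈ Ioo (-(⌈|t|⌉₊ + 1 : ℝ)) (⌈|t|⌉₊ + 1) := fun t => by
    have h := Nat.le_ceil |t|
    have h1 := abs_le.1 h
    constructor <;> linarith [h1.1, h1.2]
  have eqn : ∀ (n : ℕ) t, t ∈ Ioo (-(n + 1 : ℝ)) (n + 1) → z ⌈|t|⌉₊ t = z n t := fun n t ht => by
    rcases le_total ⌈|t|⌉₊ n with h | h
    · exact agree _ _ h (mem t)
    · exact (agree _ _ h ht).symm
  -- The index ⌈|t|⌉₊ places t inside the open interval on which that local solution is valid.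
  refine ⟨fun t => z ⌈|t|⌉₊ t, hz0 _, fun t => ?_⟩
  refine (hz ⌈|t|⌉₊ t (mem t)).congr_of_eventuallyEq ?_
  filter_upwards [Ioo_mem_nhds (mem t).1 (mem t).2] with s hs
  exact eqn _ s hs

end Ode

/-- A bounded, globally Lipschitz modification of a `C¹` function outside `[-R, R]`, which keeps
the sign condition. -/
theorem exists_truncation {k : ℝ → ℝ} (hk : ContDiff ℝ 1 k) {R : ℝ} (hR : 0 < R) :
    ∃ l : ℝ → ℝ, (∃ K, LipschitzWith K l) ∧ (∃ M, ∀ x, |l x| ≤ M) ∧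
      (∀ x, |x| ≤ R → l x = k x) ∧ ((∀ x, 0 ≤ x * k x) → ∀ x, 0 ≤ x * l x) := by
  obtain ⟨K, hK⟩ := (hk.contDiffOn (s := Icc (-R) R)).exists_lipschitzOnWith one_ne_zero
    (convex_Icc _ _) isCompact_Icc
  obtain ⟨M, hM⟩ := isCompact_Icc.exists_bound_of_continuousOn
    (hk.continuous.continuousOn (s := Icc (-R) R))
  have hcl : ∀ x, max (-R) (min R x) ∈ Icc (-R) R := fun x =>
    ⟨le_max_left _ _, max_le (by linarith) (min_le_left _ _)⟩
  have heq : ∀ x, |x| ≤ R → max (-R) (min R x) = x := fun x hx => by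
    rw [min_eq_right (abs_le.1 hx).2, max_eq_right (abs_le.1 hx).1]
  have hlip : LipschitzWith 1 fun x : ℝ => max (-R) (min R x) :=
    (LipschitzWith.id.const_min R).const_max (-R)
  -- Clamp the argument to [-R, R]; beyond it the clamped value ±R has the sign of x, which
  -- preserves the sign condition.
  refine ⟨fun x => k (max (-R) (min R x)), ⟨K, ?_⟩, ⟨M, fun x => hM _ (hcl x)⟩,
    fun x hx => congrArg k (heq x hx), fun h x => ?_⟩
  · have := hK.comp (hlip.lipschitzOnWith (s := univ)) (fun x _ => hcl x)
    rw [mul_one, lipschitzOnWith_univ] at this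
    exact this
  · rcases le_or_gt |x| R with hx | hx
    · simpa only [heq x hx] using h x
    · rcases lt_abs.1 hx with h1 | h1
      · have e : max (-R) (min R x) = R := by
          rw [min_eq_left h1.le, max_eq_right (by linarith)]
        have h2 := nonneg_of_mul_nonneg_right (h R) hR
        simp only [e]
        exact mul_nonneg (by linarith) h2
      · have e : max (-R) (min R x) = -R := by
          rw [min_eq_right (by linarith), max_eq_left (by linarith)]
        have h2 : k (-R) ≤ 0 := by have := h (-R); nlinarith
        simp only [e]
        exact mul_nonneg_of_nonpos_of_nonpos (by linarith) h2

/-! ### The semilinear equation: energy decay, Duhamel's formula, uniqueness -/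

section Semilinear

variable {H : Type*} [NormedAddCommGroup H] [InnerProductSpace ℝ H]
  {B : H →L[ℝ] H} {U : ℝ → H →L[ℝ] H}

/-- The nonlinearity `x ↦ -(k₁ (2 ⟪B x, e⟫) + k₂ (2 ⟪x, e⟫)) e`. -/
noncomputable def feedback (B : H →L[ℝ] H) (e : H) (k₁ k₂ : ℝ → ℝ) (x : H) : H :=
  -(k₁ (2 * inner ℝ (B x) e) + k₂ (2 * inner ℝ x e)) • e

theorem exists_lipschitzWith_feedback (B : H →L[ℝ] H) (e : H) {k₁ k₂ : ℝ → ℝ} {K₁ K₂ : NNReal}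
    (h₁ : LipschitzWith K₁ k₁) (h₂ : LipschitzWith K₂ k₂) :
    ∃ K, LipschitzWith K fun x => k₁ (2 * inner ℝ (B x) e) + k₂ (2 * inner ℝ x e) := by
  have e1 : ∀ x, 2 * inner ℝ (B x) e = ((2 : ℝ) • (innerSL ℝ e).comp B) x := fun x => by
    simp [real_inner_comm]
  have e2 : ∀ x, 2 * inner ℝ x e = ((2 : ℝ) • innerSL ℝ e) x := fun x => by
    simp [real_inner_comm]
  simp only [e1, e2]
  exact ⟨_, (h₁.comp (ContinuousLinearMap.lipschitz _)).add
    (h₂.comp (ContinuousLinearMap.lipschitz _))⟩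

theorem lipschitzWith_neg_smul {F : H → ℝ} {K : NNReal} (hF : LipschitzWith K F) (e : H) :
    LipschitzWith (K * ‖e‖₊) fun x => -F x • e := by
  refine LipschitzWith.of_dist_le_mul fun x y => ?_
  have : -F x • e - -F y • e = -(F x - F y) • e := by module
  rw [dist_eq_norm, this, norm_smul, norm_neg, ← dist_eq_norm]
  have := hF.dist_le_mul x y
  push_cast
  nlinarith [norm_nonneg e]

theorem abs_pairing_le (B : H →L[ℝ] H) (e : H) {R : ℝ} {x : H} (hx : ‖x‖ ≤ R) :
    |2 * inner ℝ (B x) e| ≤ 2 * (‖B‖ * R * ‖e‖) ∧ |2 * inner ℝ x e| ≤ 2 * (R * ‖e‖) := by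
  have h1 := abs_real_inner_le_norm (B x) e
  have h2 := abs_real_inner_le_norm x e
  have h3 := B.le_opNorm_of_le hx
  rw [abs_mul, abs_mul, abs_two]
  constructor
  · nlinarith [norm_nonneg e]
  · nlinarith [norm_nonneg e]

/-- On a ball both scalar arguments stay in a fixed interval, where k₁, k₂ coincide with globally
Lipschitz truncations. -/
theorem exists_lipschitzOnWith_feedback (B : H →L[ℝ] H) (e : H) {k₁ k₂ : ℝ → ℝ}
    (h₁ : ContDiff ℝ 1 k₁) (h₂ : ContDiff ℝ 1 k₂) (R : ℝ) :
    ∃ K, LipschitzOnWith K (feedback B e k₁ k₂) (Metric.closedBall 0 R) := by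
  -- The 1 only ensures r > 0, also when e = 0 or R ≤ 0.
  set r := max 1 (max (2 * (‖B‖ * R * ‖e‖)) (2 * (R * ‖e‖))) with hr
  have r0 : 0 < r := lt_max_of_lt_left one_pos
  obtain ⟨l₁, ⟨K₁, hl₁⟩, -, e₁, -⟩ := exists_truncation h₁ r0
  obtain ⟨l₂, ⟨K₂, hl₂⟩, -, e₂, -⟩ := exists_truncation h₂ r0
  obtain ⟨K, hK⟩ := exists_lipschitzWith_feedback B e hl₁ hl₂
  refine ⟨K * ‖e‖₊, ?_⟩
  have h := (lipschitzWith_neg_smul hK e).lipschitzOnWith (s := Metric.closedBall 0 R)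
  have heq : EqOn (feedback B e k₁ k₂)
      (fun x => -(l₁ (2 * inner ℝ (B x) e) + l₂ (2 * inner ℝ x e)) • e)
      (Metric.closedBall 0 R) := fun x hx => ?_
  · intro x hx y hy
    rw [heq hx, heq hy]
    exact h hx hy
  obtain ⟨b1, b2⟩ := abs_pairing_le B e (mem_closedBall_zero_iff.1 hx)
  simp only [feedback]
  rw [e₁ _ (b1.trans ((le_max_left _ _).trans (le_max_right _ _))),
    e₂ _ (b2.trans ((le_max_right _ _).trans (le_max_right _ _)))]

theorem IsSkewGroup.continuous_apply (hU : IsSkewGroup B U) {f : ℝ → ℝ} {y : ℝ → H}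
    (hf : Continuous f) (hy : Continuous y) : Continuous fun t => U (f t) (y t) :=
  continuous_iff_continuousAt.2 fun t => hU.tendsto (hf.tendsto t) (hy.tendsto t)

theorem IsSkewGroup.lipschitzOnWith_conj (hU : IsSkewGroup B U) {N : H → H} {K : NNReal} {R : ℝ}
    (hN : LipschitzOnWith K N (Metric.closedBall 0 R)) (t : ℝ) :
    LipschitzOnWith K (fun x => U (-t) (N (U t x))) (Metric.closedBall 0 R) := by
  refine LipschitzOnWith.of_dist_le_mul fun x hx y hy => ?_
  have h := hN.dist_le_mul (U t x) (by simpa [hU.norm_apply] using hx) (U t y)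
    (by simpa [hU.norm_apply] using hy)
  rw [dist_eq_norm (U t x), ← map_sub, hU.norm_apply, ← dist_eq_norm] at h
  rwa [dist_eq_norm, ← map_sub, hU.norm_apply, ← dist_eq_norm]

theorem IsSkewGroup.lipschitzWith_conj (hU : IsSkewGroup B U) {N : H → H} {K : NNReal}
    (hN : LipschitzWith K N) (t : ℝ) : LipschitzWith K (fun x => U (-t) (N (U t x))) := by
  refine LipschitzWith.of_dist_le_mul fun x y => ?_
  have h := hN.dist_le_mul (U t x) (U t y)
  rw [dist_eq_norm (U t x), ← map_sub, hU.norm_apply, ← dist_eq_norm] at h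
  rwa [dist_eq_norm, ← map_sub, hU.norm_apply, ← dist_eq_norm]

/-- The weak form of `y' = B⁻¹ y + n` for `y = U z`, `z' = U (-·) n`. -/
theorem IsSkewGroup.hasDerivAt_inner (hU : IsSkewGroup B U) {z : ℝ → H} {n : H} {t : ℝ}
    (hz : HasDerivAt z (U (-t) n) t) (x : H) :
    HasDerivAt (fun t => inner ℝ (U t (z t)) (B x))
      (inner ℝ n (B x) - inner ℝ (U t (z t)) x) t := by
  have h2 := hz.inner ℝ (hU.hasDerivAt_neg t x)
  have e : inner ℝ n (B x) - inner ℝ (U t (z t)) x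
      = inner ℝ (z t) (-U (-t) x) + inner ℝ (U (-t) n) (U (-t) (B x)) := by
    rw [hU.inner_apply_apply, inner_neg_right, hU.inner_apply_left]; ring
  rw [e]
  simpa only [hU.inner_apply_left] using h2

/-- The energy decays along the flow. -/
theorem IsSkewGroup.antitone_energy (hU : IsSkewGroup B U)
    (hB : ∀ x y, inner ℝ (B x) y = -inner ℝ x (B y)) {e : H} {k₁ k₂ : ℝ → ℝ}
    (h₁ : Continuous k₁) (h₂ : ∀ x, 0 ≤ x * k₂ x) {z : ℝ → H}
    (hz : ∀ t, HasDerivAt z (U (-t) (feedback B e k₁ k₂ (U t (z t)))) t) :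
    Antitone fun t => ‖U t (z t)‖ ^ 2 + ∫ s in (0 : ℝ)..2 * inner ℝ (B (U t (z t))) e, k₁ s := by
  -- Thanks to this the feedback force, a multiple of e, drops out of the derivative of ⟨y, Be⟩.
  have hee : inner ℝ e (B e) = 0 := by
    have := hB e e
    rw [real_inner_comm] at this
    linarith
  have hder : ∀ t, HasDerivAt
      (fun t => ‖U t (z t)‖ ^ 2 + ∫ s in (0 : ℝ)..2 * inner ℝ (B (U t (z t))) e, k₁ s)
      (-(2 * inner ℝ (U t (z t)) e * k₂ (2 * inner ℝ (U t (z t)) e))) t := fun t => by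
    -- The norm of U z is that of z, which is differentiable although U z need not be.
    have d1 : HasDerivAt (fun t => ‖U t (z t)‖ ^ 2)
        (2 * inner ℝ (U t (z t)) (feedback B e k₁ k₂ (U t (z t)))) t := by
      have h := (hz t).norm_sq
      rw [← hU.inner_apply_left] at h
      simpa only [hU.norm_apply] using h
    have d2 : HasDerivAt (fun t => 2 * inner ℝ (B (U t (z t))) e)
        (2 * inner ℝ (U t (z t)) e) t := by
      have h := (hU.hasDerivAt_inner (hz t) e).const_mul (-2)
      have e1 : inner ℝ (feedback B e k₁ k₂ (U t (z t))) (B e) = 0 := by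
        rw [feedback, real_inner_smul_left, hee, mul_zero]
      rw [e1] at h
      have e2 : (fun t => 2 * inner ℝ (B (U t (z t))) e)
          = fun t => -2 * inner ℝ (U t (z t)) (B e) := by
        ext t; rw [hB]; ring
      rw [e2]
      exact h.congr_deriv (by ring)
    have d3 := (intervalIntegral.integral_hasDerivAt_right
      (h₁.intervalIntegrable 0 (2 * inner ℝ (B (U t (z t))) e))
      h₁.stronglyMeasurable.stronglyMeasurableAtFilter h₁.continuousAt).comp t d2
    refine (d1.add d3).congr_deriv ?_
    rw [feedback, real_inner_smul_right]; ring
  refine antitone_of_deriv_nonpos (fun t => (hder t).differentiableAt) fun t => ?_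
  rw [(hder t).deriv]
  exact neg_nonpos.2 (h₂ _)

variable [CompleteSpace H]

theorem IsSkewGroup.duhamel (hU : IsSkewGroup B U) {z n : ℝ → H} (hn : Continuous n)
    (hz : ∀ t, HasDerivAt z (U (-t) (n t)) t) (t : ℝ) :
    U t (z t) = U t (z 0) + ∫ s in (0 : ℝ)..t, U (t - s) (n s) := by
  have hc : Continuous fun s => U (-s) (n s) := hU.continuous_apply continuous_neg hn
  have h := intervalIntegral.integral_eq_sub_of_hasDerivAt (fun s _ => hz s)
    (hc.intervalIntegrable 0 t)
  have e : ∫ s in (0 : ℝ)..t, U (t - s) (n s) = U t (∫ s in (0 : ℝ)..t, U (-s) (n s)) := by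
    rw [← ContinuousLinearMap.intervalIntegral_comp_comm _ (hc.intervalIntegrable 0 t)]
    refine intervalIntegral.integral_congr fun s _ => ?_
    change _ = U t (U (-s) (n s))
    rw [← hU.add_apply, sub_eq_add_neg]
  rw [e, h, ← map_add, add_sub_cancel]

/-- Solutions of Duhamel's formula are unique. -/
theorem IsSkewGroup.eqOn_of_duhamel (hU : IsSkewGroup B U) {N : H → H}
    (hN : ∀ R, ∃ K, LipschitzOnWith K N (Metric.closedBall 0 R)) {b : ℝ} {y₀ : H} {y w : ℝ → H}
    (hyc : ContinuousOn y (Icc 0 b))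
    (hy : ∀ t ∈ Icc 0 b, y t = U t y₀ + ∫ s in (0 : ℝ)..t, U (t - s) (N (y s)))
    (hwc : ContinuousOn w (Icc 0 b))
    (hw : ∀ t ∈ Icc 0 b, w t = U t y₀ + ∫ s in (0 : ℝ)..t, U (t - s) (N (w s))) :
    EqOn y w (Icc 0 b) := by
  rcases lt_or_ge b 0 with hb | hb
  · rw [Icc_eq_empty (not_le.2 hb)]; exact eqOn_empty _ _
  have hNc : Continuous N := by
    refine continuous_iff_continuousAt.2 fun x => ?_
    obtain ⟨K, hK⟩ := hN (‖x‖ + 1)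
    refine hK.continuousOn.continuousAt (mem_of_superset (Metric.ball_mem_nhds x one_pos) ?_)
    intro x' hx'
    rw [mem_closedBall_zero_iff]
    have := norm_le_norm_add_norm_sub' x' x
    rw [mem_ball_iff_norm] at hx'
    linarith
  have key : ∀ y : ℝ → H, ContinuousOn y (Icc 0 b) →
      (∀ t ∈ Icc 0 b, y t = U t y₀ + ∫ s in (0 : ℝ)..t, U (t - s) (N (y s))) →
      ∀ t ∈ Ico 0 b, HasDerivWithinAt (fun t => U (-t) (y t))
        (U (-t) (N (U t (U (-t) (y t))))) (Ici t) t := by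
    intro y hyc hy t ht
    have hgc : ContinuousOn (fun s => U (-s) (N (y s))) (Icc 0 b) :=
      hU.continuousOn continuousOn_neg (hNc.comp_continuousOn hyc)
    -- A continuous extension of the integrand to the line, so that the fundamental theorem applies
    -- at the endpoints too.
    set G : ℝ → H := IccExtend hb ((Icc 0 b).domRestrict fun s => U (-s) (N (y s))) with hG
    have hGc : Continuous G := (continuousOn_iff_continuous_domRestrict.1 hgc).Icc_extend'
    have hGe : ∀ s ∈ Icc 0 b, G s = U (-s) (N (y s)) := fun s hs => IccExtend_of_mem hb _ hs
    have e : ∀ r ∈ Icc 0 b, U (-r) (y r) = y₀ + ∫ s in (0 : ℝ)..r, G s := fun r hr => by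
      rw [hy r hr, map_add, hU.neg_apply_apply]
      congr 1
      have h1 : ∫ s in (0 : ℝ)..r, U (r - s) (N (y s)) = ∫ s in (0 : ℝ)..r, U r (G s) := by
        refine intervalIntegral.integral_congr fun s hs => ?_
        rw [uIcc_of_le hr.1] at hs
        rw [hGe s ⟨hs.1, hs.2.trans hr.2⟩, ← hU.add_apply, sub_eq_add_neg]
      rw [h1, ContinuousLinearMap.intervalIntegral_comp_comm _ (hGc.intervalIntegrable 0 r),
        hU.neg_apply_apply]
    have hd := ((intervalIntegral.integral_hasDerivAt_right (hGc.intervalIntegrable 0 t)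
      hGc.stronglyMeasurable.stronglyMeasurableAtFilter hGc.continuousAt).const_add
        y₀).hasDerivWithinAt (s := Ici t)
    rw [hU.apply_neg_apply, ← hGe t ⟨ht.1, ht.2.le⟩]
    refine hd.congr_of_eventuallyEq ?_ (e t ⟨ht.1, ht.2.le⟩)
    filter_upwards [self_mem_nhdsWithin, mem_nhdsWithin_of_mem_nhds (Iio_mem_nhds ht.2)] with r h1 h2
    exact e r ⟨ht.1.trans h1, le_of_lt h2⟩
  obtain ⟨R₁, hR₁⟩ := isCompact_Icc.exists_bound_of_continuousOn hyc
  obtain ⟨R₂, hR₂⟩ := isCompact_Icc.exists_bound_of_continuousOn hwc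
  -- Both solutions, and their images under U(-t), stay in this ball, so one Lipschitz constant
  -- serves Gronwall.
  obtain ⟨K, hK⟩ := hN (max R₁ R₂)
  have h := ODE_solution_unique_of_mem_Icc_right (v := fun t x => U (-t) (N (U t x)))
    (s := fun _ => Metric.closedBall 0 (max R₁ R₂)) (a := 0) (b := b)
    (f := fun t => U (-t) (y t)) (g := fun t => U (-t) (w t))
    (fun t _ => hU.lipschitzOnWith_conj hK t)
    (hU.continuousOn continuousOn_neg hyc) (key y hyc hy)
    (fun t ht => by
      rw [mem_closedBall_zero_iff, hU.norm_apply]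
      exact (hR₁ t (Ico_subset_Icc_self ht)).trans (le_max_left _ _))
    (hU.continuousOn continuousOn_neg hwc) (key w hwc hw)
    (fun t ht => by
      rw [mem_closedBall_zero_iff, hU.norm_apply]
      exact (hR₂ t (Ico_subset_Icc_self ht)).trans (le_max_right _ _))
    (by
      have h0 : (0 : ℝ) ∈ Icc 0 b := ⟨le_rfl, hb⟩
      change U (-0) (y 0) = U (-0) (w 0)
      rw [hy 0 h0, hw 0 h0]; simp)
  intro t ht
  have := congrArg (U t) (h ht)
  simpa only [hU.apply_neg_apply] using this

end Semilinear

/-! ### Regularity for data in the domain, and global existence -/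

section Regularity

variable {H : Type*} [NormedAddCommGroup H] [InnerProductSpace ℝ H]
  {B : H →L[ℝ] H} {U : ℝ → H →L[ℝ] H}

theorem eq_zero_of_inner_range {B : H →L[ℝ] H} (hB : ∀ x y, inner ℝ (B x) y = -inner ℝ x (B y))
    (hi : Function.Injective B) {v : H} (h : ∀ x, inner ℝ v (B x) = 0) : v = 0 := by
  refine hi ?_
  rw [map_zero]
  refine ext_inner_right ℝ fun x => ?_
  rw [hB, h x]; simp

/-- Solutions starting in the range of `B` are Lipschitz continuous in time. -/
theorem IsSkewGroup.norm_sub_le_of_mem_range (hU : IsSkewGroup B U) {N : H → H} {K : NNReal}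
    (hN : LipschitzWith K N) {M : ℝ} (hM : ∀ x, ‖N x‖ ≤ M) {q₀ : H} {z : ℝ → H}
    (hz₀ : z 0 = B q₀) (hz : ∀ t, HasDerivAt z (U (-t) (N (U t (z t)))) t) {T s t : ℝ}
    (ht : t ∈ Icc 0 T) :
    ‖U s (z s) - U t (z t)‖ ≤ (M + ‖q₀‖) * Real.exp (K * T) * ‖s - t‖ := by
  have hM0 : 0 ≤ M := (norm_nonneg _).trans (hM 0)
  set h := s - t with hh
  -- The first increment: the forcing contributes at most M|h|, and the free orbit of Bq₀ at most
  -- ‖q₀‖|h|.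
  have h0 : ‖U h (z h) - z 0‖ ≤ (M + ‖q₀‖) * ‖h‖ := by
    have e1 : ‖z h - z 0‖ ≤ M * ‖h - 0‖ :=
      Convex.norm_image_sub_le_of_norm_hasDerivWithin_le (s := univ)
        (fun r _ => (hz r).hasDerivWithinAt) (fun r _ => by rw [hU.norm_apply]; exact hM _)
        convex_univ trivial trivial
    have e2 : ‖U h (B q₀) - U 0 (B q₀)‖ ≤ ‖q₀‖ * ‖h - 0‖ :=
      Convex.norm_image_sub_le_of_norm_hasDerivWithin_le (s := univ)
        (f := fun r => U r (B q₀)) (fun r _ => (hU.hasDerivAt r q₀).hasDerivWithinAt)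
        (fun r _ => by rw [hU.norm_apply]) convex_univ trivial trivial
    have e3 : U h (z h) - z 0 = U h (z h - z 0) + (U h (B q₀) - U 0 (B q₀)) := by
      rw [map_sub, hU.zero, hz₀]; simp
    rw [e3]
    refine (norm_add_le _ _).trans ?_
    rw [hU.norm_apply]
    rw [sub_zero] at e1 e2
    linarith
  -- By autonomy the time-shifted solution, in the rotated variable, solves the same equation;
  -- Gronwall compares it with z.
  have hzh : ∀ r, HasDerivAt (fun r => U h (z (r + h))) (U (-r) (N (U r (U h (z (r + h)))))) r :=
    fun r => by
      have h1 := (U h).hasFDerivAt.comp_hasDerivAt r ((hz (r + h)).comp_add_const r h)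
      have e : U h (U (-(r + h)) (N (U (r + h) (z (r + h)))))
          = U (-r) (N (U r (U h (z (r + h))))) := by
        rw [← hU.add_apply h, ← hU.add_apply r]
        congr 2; ring
      rw [← e]
      exact h1
  have hcont : ∀ f f' : ℝ → H, (∀ r, HasDerivAt f (f' r) r) → ContinuousOn f (Icc 0 T) :=
    fun f f' hf r _ => (hf r).continuousAt.continuousWithinAt
  have hgr := dist_le_of_trajectories_ODE (v := fun t x => U (-t) (N (U t x))) (K := K)
    (f := fun r => U h (z (r + h))) (g := z) (a := 0) (b := T) (δ := (M + ‖q₀‖) * ‖h‖)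
    (fun r => hU.lipschitzWith_conj hN r) (hcont _ _ hzh) (fun r _ => (hzh r).hasDerivWithinAt)
    (hcont _ _ hz) (fun r _ => (hz r).hasDerivWithinAt)
    (by rw [dist_eq_norm]; simpa using h0) t ht
  have e : U s (z s) - U t (z t) = U t (U h (z (t + h)) - z t) := by
    rw [map_sub, ← hU.add_apply, hh, add_sub_cancel]
  rw [e, hU.norm_apply, ← dist_eq_norm]
  refine hgr.trans ?_
  have h1 : Real.exp (K * (t - 0)) ≤ Real.exp (K * T) := by
    refine Real.exp_le_exp.2 (mul_le_mul_of_nonneg_left ?_ K.coe_nonneg)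
    linarith [ht.2]
  calc (M + ‖q₀‖) * ‖h‖ * Real.exp (K * (t - 0)) ≤ (M + ‖q₀‖) * ‖h‖ * Real.exp (K * T) := by
        gcongr
    _ = _ := by ring

theorem intervalIntegrable_smul_orbit (hU : IsSkewGroup B U) {φ : ℝ → ℝ} {a b : ℝ}
    (hφ : IntervalIntegrable φ volume a b) (e : H) :
    IntervalIntegrable (fun s => φ s • U (-s) e) volume a b :=
  hφ.smul_continuousOn (hU.continuous_apply continuous_neg continuous_const).continuousOn

variable [CompleteSpace H]

/-- Integration by parts in `∫ φ U (-s) e`. -/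
theorem IsSkewGroup.eq_apply_of_hasDerivAt (hU : IsSkewGroup B U) {φ : ℝ → ℝ} {e : H}
    (hφc : Continuous φ) {z : ℝ → H} (hz : ∀ t, HasDerivAt z (U (-t) (-φ t • e)) t) {t : ℝ}
    (hφ : AbsolutelyContinuousOnInterval φ 0 t) :
    z t = z 0 + B (φ t • U (-t) e - φ 0 • e - ∫ s in (0 : ℝ)..t, deriv φ s • U (-s) e) := by
  -- Testing against x reduces the claim to integration by parts for real absolutely continuous
  -- functions, since -U(-s)e is the derivative of B U(-s)e.
  refine ext_inner_right ℝ fun x => ?_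
  have hg : ∀ s, HasDerivAt (fun s => inner ℝ (B (U (-s) e)) x) (-inner ℝ (U (-s) e) x) s :=
    fun s => by
      have h := (hU.hasDerivAt_neg s e).inner ℝ (hasDerivAt_const s x)
      rw [inner_zero_right, zero_add, inner_neg_left] at h
      simpa only [← hU.comm] using h
  have hgd : (deriv fun s => inner ℝ (B (U (-s) e)) x) = fun s => -inner ℝ (U (-s) e) x :=
    funext fun s => (hg s).deriv
  have hUe : Continuous fun s => inner ℝ (U (-s) e) x :=
    (hU.continuous_apply continuous_neg continuous_const).inner continuous_const
  have hgac : AbsolutelyContinuousOnInterval (fun s => inner ℝ (B (U (-s) e)) x) 0 t := by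
    refine ContDiffOn.absolutelyContinuousOnInterval (ContDiff.contDiffOn ?_)
    rw [contDiff_one_iff_deriv, hgd]
    exact ⟨fun s => (hg s).differentiableAt, hUe.neg⟩
  have hparts := hφ.integral_mul_deriv_eq_deriv_mul hgac
  rw [hgd] at hparts
  have hftc : ∫ s in (0 : ℝ)..t, φ s * -inner ℝ (U (-s) e) x
      = inner ℝ (z t) x - inner ℝ (z 0) x := by
    refine intervalIntegral.integral_eq_sub_of_hasDerivAt (f := fun s => inner ℝ (z s) x)
      (fun s _ => ?_) ((hφc.mul hUe.neg).intervalIntegrable 0 t)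
    have h := (hz s).inner ℝ (hasDerivAt_const s x)
    refine h.congr_deriv ?_
    rw [inner_zero_right, zero_add, map_smul, real_inner_smul_left]; ring
  have hint : inner ℝ (B (∫ s in (0 : ℝ)..t, deriv φ s • U (-s) e)) x
      = ∫ s in (0 : ℝ)..t, deriv φ s * inner ℝ (B (U (-s) e)) x := by
    have h := ContinuousLinearMap.intervalIntegral_comp_comm ((innerSL ℝ x).comp B)
      (intervalIntegrable_smul_orbit hU hφ.intervalIntegrable_deriv e)
    rw [real_inner_comm]
    refine h.symm.trans (intervalIntegral.integral_congr fun s _ => ?_)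
    simp [real_inner_comm]
  rw [hftc] at hparts
  rw [inner_add_left, map_sub, map_sub, inner_sub_left, inner_sub_left, hint, map_smul, map_smul,
    real_inner_smul_left, real_inner_smul_left]
  simp only [neg_zero, hU.zero, ContinuousLinearMap.id_apply] at hparts
  linarith

/-- The force has a fixed direction e, so only its scalar coefficient φ must be differentiated, and
for that φ Lipschitz suffices. Integration by parts gives y = B(w + φe); the equation then predicts
y' = (w + φe) - φe = w, which is continuous. -/
theorem IsSkewGroup.hasDerivAt_of_mem_range (hU : IsSkewGroup B U)
    (hB : ∀ x y, inner ℝ (B x) y = -inner ℝ x (B y)) (hi : Function.Injective B)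
    {F : H → ℝ} {K : NNReal} (hF : LipschitzWith K F) {M : ℝ} (hM : ∀ x, |F x| ≤ M) {e q₀ : H}
    {z : ℝ → H} (hz₀ : z 0 = B q₀)
    (hz : ∀ t, HasDerivAt z (U (-t) (-F (U t (z t)) • e)) t) :
    ∃ w : ℝ → H, ContinuousOn w (Ioi 0) ∧ ∀ t, 0 < t →
      HasDerivAt (fun t => U t (z t)) (w t) t ∧
      ∃ q, U t (z t) = B q ∧ w t = q + -F (U t (z t)) • e := by
  have hzc : Continuous z := continuous_iff_continuousAt.2 fun t => (hz t).continuousAt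
  set φ : ℝ → ℝ := fun t => F (U t (z t)) with hφ
  have hφc : Continuous φ := hF.continuous.comp (hU.continuous_apply continuous_id hzc)
  have hac : ∀ T, 0 ≤ T → AbsolutelyContinuousOnInterval φ 0 T := fun T hT => by
    have hM' : ∀ x, ‖-F x • e‖ ≤ M * ‖e‖ := fun x => by
      rw [norm_smul, norm_neg, Real.norm_eq_abs]
      exact mul_le_mul_of_nonneg_right (hM x) (norm_nonneg e)
    set C := (M * ‖e‖ + ‖q₀‖) * Real.exp ((K * ‖e‖₊ : NNReal) * T) with hC
    have hC0 : 0 ≤ C := mul_nonneg (add_nonneg ((norm_nonneg _).trans (hM' 0)) (norm_nonneg _))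
      (Real.exp_nonneg _)
    refine LipschitzOnWith.absolutelyContinuousOnInterval (K := K * C.toNNReal) ?_
    rw [uIcc_of_le hT]
    refine LipschitzOnWith.of_dist_le_mul fun s _ t ht => ?_
    have h1 := hF.dist_le_mul (U s (z s)) (U t (z t))
    have h2 := hU.norm_sub_le_of_mem_range (lipschitzWith_neg_smul hF e) hM' hz₀ hz (s := s) ht
    rw [← dist_eq_norm, ← dist_eq_norm] at h2
    refine h1.trans ?_
    rw [NNReal.coe_mul, mul_assoc, Real.coe_toNNReal C hC0]
    exact mul_le_mul_of_nonneg_left h2 K.coe_nonneg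
  set G : ℝ → H := fun t => ∫ s in (0 : ℝ)..t, deriv φ s • U (-s) e with hG
  set w : ℝ → H := fun t => U t (q₀ - φ 0 • e - G t) with hw
  have hwc : ∀ T, 0 ≤ T → ContinuousOn w (Icc 0 T) := fun T hT => by
    have h := intervalIntegral.continuousOn_primitive_interval'
      (intervalIntegrable_smul_orbit hU (hac T hT).intervalIntegrable_deriv e) left_mem_uIcc
    rw [uIcc_of_le hT] at h
    exact hU.continuousOn continuousOn_id (continuousOn_const.sub h)
  have hrange : ∀ t, 0 ≤ t → U t (z t) = B (w t + φ t • e) := fun t ht => by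
    have h1 : z t = B (q₀ - φ 0 • e - G t + φ t • U (-t) e) := by
      rw [hU.eq_apply_of_hasDerivAt hφc hz (hac t ht), hz₀, ← map_add]
      congr 1; abel
    rw [h1, hU.comm, map_add, map_smul, hU.apply_neg_apply]
  -- Differentiability of y is not yet known, so the identity is tested against the dense range of
  -- B, where the weak equation holds; the φe terms cancel.
  have hint : ∀ t, 0 ≤ t → U t (z t) = z 0 + ∫ s in (0 : ℝ)..t, w s := fun t ht => by
    rw [← sub_eq_zero]
    refine eq_zero_of_inner_range hB hi fun x => ?_
    have hwi : IntervalIntegrable w volume 0 t := by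
      refine ContinuousOn.intervalIntegrable ?_
      rw [uIcc_of_le ht]
      exact hwc t ht
    have h1 : ∫ s in (0 : ℝ)..t, inner ℝ (w s) (B x)
        = inner ℝ (U t (z t)) (B x) - inner ℝ (U 0 (z 0)) (B x) := by
      refine intervalIntegral.integral_eq_sub_of_hasDerivAt
        (f := fun s => inner ℝ (U s (z s)) (B x)) (fun s hs => ?_) ?_
      · rw [uIcc_of_le ht] at hs
        refine (hU.hasDerivAt_inner (hz s) x).congr_deriv ?_
        rw [hrange s hs.1, hB, ← hrange s hs.1, inner_add_left, real_inner_smul_left,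
          real_inner_smul_left]
        ring
      · refine ContinuousOn.intervalIntegrable ?_
        rw [uIcc_of_le ht]
        exact (hwc t ht).inner continuousOn_const
    have h2 : inner ℝ (∫ s in (0 : ℝ)..t, w s) (B x) = ∫ s in (0 : ℝ)..t, inner ℝ (w s) (B x) := by
      have h := ContinuousLinearMap.intervalIntegral_comp_comm (innerSL ℝ (B x)) hwi
      rw [real_inner_comm]
      refine h.symm.trans (intervalIntegral.integral_congr fun s _ => ?_)
      simp [real_inner_comm]
    rw [inner_sub_left, inner_add_left, h2, h1, hU.zero]
    simp
  refine ⟨w, fun t ht => ?_, fun t ht => ⟨?_, _, hrange t ht.le, by module⟩⟩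
  · exact ((hwc (t + 1) (by linarith [mem_Ioi.1 ht])).continuousAt
      (Icc_mem_nhds ht (by linarith))).continuousWithinAt
  · have hc := hwc (t + 1) (by linarith)
    have h := (intervalIntegral.integral_hasDerivAt_right (f := w) (a := 0) (b := t)
      ((hc.mono (by rw [uIcc_of_le ht.le]; exact Icc_subset_Icc_right (by linarith))).intervalIntegrable)
      ((hc.mono Ioo_subset_Icc_self).stronglyMeasurableAtFilter isOpen_Ioo t ⟨ht, by linarith⟩)
      (hc.continuousAt (Icc_mem_nhds ht (by linarith)))).const_add (z 0)
    refine h.congr_of_eventuallyEq ?_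
    filter_upwards [Ioi_mem_nhds ht] with s hs
    exact hint s (le_of_lt hs)

/-- Global mild solutions, their regularity, and the decay of the energy. -/
theorem IsSkewGroup.exists_global_solution (hU : IsSkewGroup B U)
    (hB : ∀ x y, inner ℝ (B x) y = -inner ℝ x (B y)) (hi : Function.Injective B) (e : H)
    {k₁ k₂ : ℝ → ℝ} (hk₁ : ContDiff ℝ 1 k₁) (hk₂ : ContDiff ℝ 1 k₂)
    (hint : ∀ x, 0 ≤ ∫ s in (0 : ℝ)..x, k₁ s) (hsign : ∀ x, 0 ≤ x * k₂ x) (y₀ : H) :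
    ∃ y : ℝ → H, Continuous y ∧
      (∀ t, 0 ≤ t → y t = U t y₀ + ∫ s in (0 : ℝ)..t, U (t - s) (feedback B e k₁ k₂ (y s))) ∧
      (y₀ ∈ range B → y 0 = y₀ ∧ ∃ w : ℝ → H, ContinuousOn w (Ioi 0) ∧ ∀ t, 0 < t →
        HasDerivAt y (w t) t ∧ ∃ q, y t = B q ∧ w t = q + feedback B e k₁ k₂ (y t)) ∧
      AntitoneOn (fun t => ‖y t‖ ^ 2 + ∫ s in (0 : ℝ)..2 * inner ℝ (B (y t)) e, k₁ s) (Ici 0) ∧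
      ∃ C, ∀ t, 0 ≤ t → ‖y t‖ ≤ C := by
  set V₀ := ‖y₀‖ ^ 2 + ∫ s in (0 : ℝ)..2 * inner ℝ (B y₀) e, k₁ s with hV₀
  set ρ := √V₀ with hρ
  -- The final + 1 makes the bounds strict on the ball of radius ρ = √V₀, which contains the energy
  -- sublevel set of y₀.
  set R := max 1 (max (2 * (‖B‖ * ρ * ‖e‖)) (2 * (ρ * ‖e‖))) + 1 with hR
  have hR0 : 0 < R := by
    have := le_max_left 1 (max (2 * (‖B‖ * ρ * ‖e‖)) (2 * (ρ * ‖e‖)))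
    linarith
  have hbound : ∀ x, ‖x‖ ≤ ρ → |2 * inner ℝ (B x) e| < R ∧ |2 * inner ℝ x e| < R :=
    fun x hx => by
      obtain ⟨h1, h2⟩ := abs_pairing_le B e hx
      have h3 := le_max_right 1 (max (2 * (‖B‖ * ρ * ‖e‖)) (2 * (ρ * ‖e‖)))
      have h4 := le_max_left (2 * (‖B‖ * ρ * ‖e‖)) (2 * (ρ * ‖e‖))
      have h5 := le_max_right (2 * (‖B‖ * ρ * ‖e‖)) (2 * (ρ * ‖e‖))
      constructor <;> linarith
  have hsmall : ∀ x, ‖x‖ ^ 2 + ∫ s in (0 : ℝ)..2 * inner ℝ (B x) e, k₁ s ≤ V₀ → ‖x‖ ≤ ρ :=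
    fun x hx => Real.le_sqrt_of_sq_le (by linarith [hint (2 * inner ℝ (B x) e)])
  obtain ⟨l₁, ⟨K₁, hl₁⟩, ⟨M₁, hM₁⟩, e₁, -⟩ := exists_truncation hk₁ hR0
  obtain ⟨l₂, ⟨K₂, hl₂⟩, ⟨M₂, hM₂⟩, e₂, s₂⟩ := exists_truncation hk₂ hR0
  obtain ⟨K, hK⟩ := exists_lipschitzWith_feedback B e hl₁ hl₂
  have hM : ∀ x, |l₁ (2 * inner ℝ (B x) e) + l₂ (2 * inner ℝ x e)| ≤ M₁ + M₂ := fun x =>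
    (abs_add_le _ _).trans (add_le_add (hM₁ _) (hM₂ _))
  have hN : LipschitzWith (K * ‖e‖₊) (feedback B e l₁ l₂) := lipschitzWith_neg_smul hK e
  obtain ⟨z, hz₀, hz⟩ := exists_global_integralCurve
    (v := fun t x => U (-t) (feedback B e l₁ l₂ (U t x))) (fun t => hU.lipschitzWith_conj hN t)
    (fun x => hU.continuous_apply continuous_neg (hN.continuous.comp (hU.continuous x)))
    (M := (M₁ + M₂) * ‖e‖) (fun t x => by
      rw [hU.norm_apply, feedback, norm_smul, norm_neg]
      exact mul_le_mul_of_nonneg_right (hM _) (norm_nonneg e)) y₀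
  have hzc : Continuous z := continuous_iff_continuousAt.2 fun t => (hz t).continuousAt
  set y : ℝ → H := fun t => U t (z t) with hy
  have hyc : Continuous y := hU.continuous_apply continuous_id hzc
  have hy₀ : y 0 = y₀ := by rw [hy]; simp [hU.zero, hz₀]
  have hanti := hU.antitone_energy hB hl₁.continuous (s₂ hsign) hz
  -- The primitive of the truncated l₁ may be negative outside [-R, R], so the energy bounds the
  -- norm only while u(L), here 2⟨By, e⟩, stays in this interval.
  have hpot : ∀ x, |x| ≤ R → ∫ s in (0 : ℝ)..x, l₁ s = ∫ s in (0 : ℝ)..x, k₁ s := fun x hx => by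
    refine intervalIntegral.integral_congr fun s hs => e₁ s ?_
    have h := abs_sub_left_of_mem_uIcc hs
    simp only [sub_zero] at h
    exact h.trans hx
  have hV0 : ‖y 0‖ ^ 2 + ∫ s in (0 : ℝ)..2 * inner ℝ (B (y 0)) e, l₁ s = V₀ := by
    rw [hpot _ (hbound _ (hsmall _ (by rw [hy₀]))).1.le, hy₀]
  have hle : ∀ t, 0 ≤ t → |2 * inner ℝ (B (y t)) e| ≤ R → ‖y t‖ ≤ ρ := fun t ht h => by
    refine hsmall _ ?_
    rw [← hV0, ← hpot _ h]
    exact hanti ht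
  -- Continuity argument: to leave the interval the quantity must attain R at some time, but there
  -- energy decay gives ‖y‖ ≤ ρ and hence a value below R.
  have hlt : ∀ t, 0 ≤ t → |2 * inner ℝ (B (y t)) e| < R := fun t ht => by
    by_contra! hcon
    have hc : ContinuousOn (fun s => |2 * inner ℝ (B (y s)) e|) (Icc 0 t) :=
      (continuous_const.mul ((B.continuous.comp hyc).inner continuous_const)).abs.continuousOn
    obtain ⟨s, hs, hs'⟩ := intermediate_value_Icc ht hc
      ⟨(hbound _ (hsmall _ (by rw [hy₀]))).1.le, hcon⟩
    exact (hbound _ (hle s hs.1 hs'.le)).1.ne hs'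
  have hnorm : ∀ t, 0 ≤ t → ‖y t‖ ≤ ρ := fun t ht => hle t ht (hlt t ht).le
  have hfb : ∀ t, 0 ≤ t → feedback B e l₁ l₂ (y t) = feedback B e k₁ k₂ (y t) := fun t ht => by
    obtain ⟨h1, h2⟩ := hbound _ (hnorm t ht)
    rw [feedback, feedback, e₁ _ h1.le, e₂ _ h2.le]
  refine ⟨y, hyc, fun t ht => ?_, ?_, ?_, ρ, hnorm⟩
  · have h := hU.duhamel (hN.continuous.comp hyc) hz t
    rw [hz₀] at h
    refine h.trans (congrArg _ (intervalIntegral.integral_congr fun s hs => ?_))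
    rw [uIcc_of_le ht] at hs
    exact congrArg _ (hfb s hs.1)
  · rintro ⟨q₀, hq₀⟩
    obtain ⟨w, hw, hw'⟩ := hU.hasDerivAt_of_mem_range hB hi hK hM (hz₀.trans hq₀.symm) hz
    refine ⟨hy₀, w, hw, fun t ht => ?_⟩
    obtain ⟨h1, q, h2, h3⟩ := hw' t ht
    exact ⟨h1, q, h2, h3.trans (congrArg _ (hfb t ht.le))⟩
  · intro s hs t ht hst
    have h := hanti hst
    simp only at h ⊢
    rwa [hpot _ (hlt s hs).le, hpot _ (hlt t ht).le] at h

end Regularity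

/-! ### The bounded inverse of a surjective skew operator -/

/-- A surjective skew-symmetric operator has a bounded skew-symmetric inverse. -/
theorem exists_skew_inverse {H : Type*} [NormedAddCommGroup H] [InnerProductSpace ℝ H]
    [CompleteSpace H] (A : H →ₗ.[ℝ] H) (hs : ∀ z, ∃ y, A y = z)
    (h0 : ∀ y : A.domain, inner ℝ (A y) (y : H) = 0) :
    ∃ B : H →L[ℝ] H, (∀ x y, inner ℝ (B x) y = -inner ℝ x (B y)) ∧ Function.Injective B ∧
      ∀ x z, (x, z) ∈ A.graph ↔ B z = x := by
  -- Polarization of ⟨Ay, y⟩ = 0.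
  have skew : ∀ y y' : A.domain, inner ℝ (A y) (y' : H) = -inner ℝ (y : H) (A y') := by
    intro y y'
    have h := h0 (y + y')
    rw [LinearPMap.map_add, Submodule.coe_add, inner_add_left, inner_add_right, inner_add_right,
      h0, h0, real_inner_comm (y : H) (A y')] at h
    linarith
  have inj : Function.Injective A.toFun := by
    rw [← LinearMap.ker_eq_bot, LinearMap.ker_eq_bot']
    intro y hy
    refine Subtype.ext (ext_inner_right ℝ fun x => ?_)
    obtain ⟨y', rfl⟩ := hs x
    have h := skew y y'
    have hy' : A y = 0 := hy
    rw [hy', inner_zero_left] at h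
    rw [Submodule.coe_zero, inner_zero_left]
    linarith
  let E := LinearEquiv.ofBijective A.toFun ⟨inj, hs⟩
  have hE : ∀ z, A (E.symm z) = z := fun z => E.apply_symm_apply z
  let g : H →ₗ[ℝ] H := A.domain.subtype ∘ₗ E.symm.toLinearMap
  have hg : ∀ x y, inner ℝ (g x) y = -inner ℝ x (g y) := fun x y => by
    have h := skew (E.symm x) (E.symm y)
    rw [hE, hE] at h
    change inner ℝ ((E.symm x : A.domain) : H) y = -inner ℝ x ((E.symm y : A.domain) : H)
    linarith
  -- Hellinger–Toeplitz: an everywhere defined skew map has closed graph.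
  have hc : Continuous g := by
    refine g.continuous_of_seq_closed_graph fun u x y hu hy => ?_
    refine ext_inner_right ℝ fun w => ?_
    rw [hg]
    have h1 : Tendsto (fun n => inner ℝ (g (u n)) w) atTop (𝓝 (inner ℝ y w)) :=
      hy.inner tendsto_const_nhds
    have h2 : Tendsto (fun n => -inner ℝ (u n) (g w)) atTop (𝓝 (-inner ℝ x (g w))) :=
      (hu.inner tendsto_const_nhds).neg
    exact tendsto_nhds_unique h1 (h2.congr fun n => (hg _ _).symm)
  refine ⟨⟨g, hc⟩, hg, fun x y hxy => E.symm.injective (Subtype.ext hxy), fun x z => ?_⟩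
  rw [LinearPMap.mem_graph_iff]
  refine ⟨?_, fun h => ⟨E.symm z, h, hE z⟩⟩
  rintro ⟨y, rfl, rfl⟩
  exact congrArg Subtype.val (E.symm_apply_apply y)

/-! ### Integration by parts and a boundary value problem on the interval -/

section Sobolev

variable {L : ℝ}

theorem ptVal_prim (hL : 0 < L) (c : ℝ) (g : L2 L) : ptVal L (prim hL c g) = c + primFun g L :=
  ptVal_eq hL (continuousOn_const.add (primFun_continuousOn hL g)) (prim_coe hL c g)
    ⟨hL.le, le_rfl⟩

/-- Integration by parts in `H¹(0, L)`. -/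
theorem inner_wderiv_left (hL : 0 < L) {n k : ℕ} {f g : L2 L} (hf : MemH (n + 1) f)
    (hg : MemH (k + 1) g) : inner ℝ (wderiv f) g =
      ptVal L f * ptVal L g - ptVal 0 f * ptVal 0 g - inner ℝ f (wderiv g) := by
  -- Absolutely continuous representatives, whose classical derivative is almost everywhere the weak
  -- one, reduce the claim to the classical formula.
  have rep : ∀ (n : ℕ) (f : L2 L), MemH (n + 1) f → ∃ F : ℝ → ℝ,
      AbsolutelyContinuousOnInterval F 0 L ∧ F 0 = ptVal 0 f ∧ F L = ptVal L f ∧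
      f =ᵐ[volume.restrict (Ioo (0 : ℝ) L)] F ∧
      wderiv f =ᵐ[volume.restrict (Ioo (0 : ℝ) L)] deriv F := by
    intro n f hf
    have e := eq_prim_of_ptVal hL hf
    refine ⟨fun x => ptVal 0 f + primFun (wderiv f) x, ?_, by simp [primFun], ?_, ?_, ?_⟩
    · exact (contDiff_const.contDiffOn.absolutelyContinuousOnInterval).add (primFun_ac hL _)
    · rw [e, ptVal_prim, ← e]
    · have h := prim_coe hL (ptVal 0 f) (wderiv f)
      rwa [← e] at h
    · rw [EventuallyEq, ae_restrict_iff' measurableSet_Ioo]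
      filter_upwards [(intervalIntegrable_L2 hL (wderiv f)).ae_hasDerivAt_integral] with x hx hx'
      have h := hx (by rw [uIcc_of_le hL.le]; exact Ioo_subset_Icc_self hx') 0 (by simp)
      exact (h.const_add (ptVal 0 f)).deriv.symm
  obtain ⟨F, hF, hF0, hFL, hFf, hFd⟩ := rep n f hf
  obtain ⟨G, hG, hG0, hGL, hGg, hGd⟩ := rep k g hg
  have h := hF.integral_mul_deriv_eq_deriv_mul hG
  rw [intervalIntegral.integral_of_le hL.le, intervalIntegral.integral_of_le hL.le,
    integral_Ioc_eq_integral_Ioo, integral_Ioc_eq_integral_Ioo, hF0, hFL, hG0, hGL] at h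
  have e1 : ∫ x in Ioo 0 L, F x * deriv G x = inner ℝ f (wderiv g) := by
    rw [← StateSpace.integral_mul_eq_inner]
    refine integral_congr_ae ?_
    filter_upwards [hFf, hGd] with x h1 h2
    rw [h1, h2]
  have e2 : ∫ x in Ioo 0 L, deriv F x * G x = inner ℝ (wderiv f) g := by
    rw [← StateSpace.integral_mul_eq_inner]
    refine integral_congr_ae ?_
    filter_upwards [hFd, hGg] with x h1 h2
    rw [h1, h2]
  rw [e1, e2] at h
  linarith

/-- The boundary value problem `u'''' = g`, `u(0) = u'(0) = 0`, `u''(L) = a`, `u'''(L) = b`. -/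
theorem exists_biharmonic (hL : 0 < L) (g : L2 L) (a b : ℝ) :
    ∃ u : H20 hL, MemH 4 (u : L2 L) ∧ wderiv (wderiv (wderiv (wderiv (u : L2 L)))) = g ∧
      ptVal L (wderiv (wderiv (u : L2 L))) = a ∧
      ptVal L (wderiv (wderiv (wderiv (u : L2 L)))) = b := by
  -- q plays u''' and r plays u''; the constants of integration are fixed by the prescribed values
  -- at L, and the last two integrations start from the clamped end.
  set q := prim hL (b - primFun g L) g with hq
  set r := prim hL (a - primFun q L) q with hr
  have h1 : HasWeakDeriv q g := hasWeakDeriv_prim hL _ g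
  have h2 : HasWeakDeriv r q := hasWeakDeriv_prim hL _ q
  obtain ⟨u, hu⟩ := exists_H20 hL r
  refine ⟨u, ?_, ?_, ?_, ?_⟩
  · refine ⟨_, u.2.1.hasWeakDeriv, _, u.2.1.wderiv.hasWeakDeriv, ?_⟩
    rw [hu]
    exact ⟨q, h2, g, h1, trivial⟩
  · rw [hu, h2.wderiv_eq, h1.wderiv_eq]
  · rw [hu, hr, ptVal_prim]; ring
  · rw [hu, h2.wderiv_eq, hq, ptVal_prim]; ring

end Sobolev

/-! ### The beam in the abstract framework -/

open StateSpace

variable {p : Params}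

/-- The first component forces v = z.u, the domain conditions then force ξ and ψ, and the other
three components form the problem of `exists_biharmonic`. -/
theorem opA_surjective (z : StateSpace p) : ∃ y, opA p y = z := by
  have hΛ := p.Λ_pos
  have hρ := p.ρ_pos
  obtain ⟨u, hu, h4, h2, h3⟩ := exists_biharmonic p.L_pos (-(p.ρ / p.Λ) • z.v) (-z.ξ / p.Λ)
    (z.ψ / p.Λ)
  refine ⟨⟨StateSpace.mk u z.u (p.J * ptVal p.L (wderiv z.u)) (p.m * ptVal p.L z.u),
    hu, z.1.2, rfl, rfl⟩, ?_⟩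
  refine Prod.ext rfl (Prod.ext ?_ (Prod.ext ?_ ?_))
  · change -(p.Λ / p.ρ) • wderiv (wderiv (wderiv (wderiv (u : L2 p.L)))) = z.v
    rw [h4, smul_smul]
    have : -(p.Λ / p.ρ) * -(p.ρ / p.Λ) = 1 := by field_simp
    rw [this, one_smul]
  · change -p.Λ * ptVal p.L (wderiv (wderiv (u : L2 p.L))) = z.ξ
    rw [h2]; field_simp
  · change p.Λ * ptVal p.L (wderiv (wderiv (wderiv (u : L2 p.L)))) = z.ψ
    rw [h3]; field_simp

/-- Two integrations by parts leave (Λ/2)(v'(L)u''(L) - v(L)u'''(L)); substituting ξ = Jv'(L) and ψ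
= mv(L) cancels it against the last two components. -/
theorem inner_opA_self (y : (opA p).domain) : inner ℝ (opA p y) (y : StateSpace p) = 0 := by
  have hρ := p.ρ_pos
  have hJ := p.J_pos
  have hm := p.m_pos
  obtain ⟨y, hu, hv, hξ, hψ⟩ := y
  rw [inner_eq, energyInner_eq]
  change p.Λ / 2 * inner ℝ (wderiv (wderiv y.v)) (wderiv (wderiv y.u))
    + p.ρ / 2 * inner ℝ (-(p.Λ / p.ρ) • wderiv (wderiv (wderiv (wderiv y.u)))) y.v
    + 1 / (2 * p.J) * (-p.Λ * ptVal p.L (wderiv (wderiv y.u)) * y.ξ)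
    + 1 / (2 * p.m) * (p.Λ * ptVal p.L (wderiv (wderiv (wderiv y.u))) * y.ψ) = 0
  rw [inner_wderiv_left p.L_pos hv.1.wderiv hu.wderiv.wderiv,
    inner_wderiv_left p.L_pos hv.1 hu.wderiv.wderiv.wderiv, hv.2.1, hv.2.2, hξ, hψ,
    real_inner_smul_left, real_inner_comm y.v]
  field_simp
  ring

theorem opA_u (y : (opA p).domain) : (opA p y).u = (y : StateSpace p).v := rfl

/-- The unit vector in the direction of the component `ψ`. -/
noncomputable def tipVector (p : Params) : StateSpace p := StateSpace.mk 0 0 0 1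

theorem inner_tipVector (y : StateSpace p) : 2 * inner ℝ y (tipVector p) = y.ψ / p.m := by
  have hm := p.m_pos
  have h1 : D2 (tipVector p) = 0 := by
    change wderiv (wderiv (0 : L2 p.L)) = 0
    rw [wderiv_zero, wderiv_zero]
  rw [inner_eq, energyInner_eq, h1]
  change 2 * (p.Λ / 2 * inner ℝ (D2 y) 0 + p.ρ / 2 * inner ℝ y.v 0
    + 1 / (2 * p.J) * (y.ξ * 0) + 1 / (2 * p.m) * (y.ψ * 1)) = y.ψ / p.m
  rw [inner_zero_right, inner_zero_right]
  field_simp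
  ring

/-- By lies in D(A) and A(By) = y, so its velocity is y.u and its ψ component is m u(L). The trace
u(L) is thus a bounded functional, with no separate trace estimate. -/
theorem inner_apply_tipVector {B : StateSpace p →L[ℝ] StateSpace p}
    (hA : ∀ x z, (x, z) ∈ (opA p).graph ↔ B z = x) (y : StateSpace p) :
    2 * inner ℝ (B y) (tipVector p) = ptVal p.L y.u := by
  have hm := p.m_pos
  obtain ⟨x, hx, hx'⟩ := (LinearPMap.mem_graph_iff _).1 ((hA (B y) y).2 rfl)
  have h1 : (B y).ψ = p.m * ptVal p.L (B y).v := by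
    change ((x : StateSpace p) = B y) at hx
    rw [← hx]
    exact x.2.2.2.2
  have h2 : y.u = (B y).v := by
    change ((x : StateSpace p) = B y) at hx
    change (opA p x = y) at hx'
    rw [← hx, ← opA_u, hx']
  rw [inner_tipVector, h1, h2]
  field_simp

theorem opN_eq_feedback {B : StateSpace p →L[ℝ] StateSpace p}
    (hA : ∀ x z, (x, z) ∈ (opA p).graph ↔ B z = x) (k₁ k₂ : ℝ → ℝ) :
    opN k₁ k₂ = feedback B (tipVector p) k₁ k₂ := by
  ext1 y
  rw [feedback, inner_apply_tipVector hA, inner_tipVector]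
  set c := k₁ (ptVal p.L y.u) with hc
  set d := k₂ (y.ψ / p.m) with hd
  refine Prod.ext ?_ (Prod.ext ?_ (Prod.ext ?_ ?_))
  · exact (smul_zero (-(c + d))).symm
  · exact (smul_zero (-(c + d))).symm
  · exact (smul_zero (-(c + d))).symm
  · change -c - d = -(c + d) * 1
    ring

theorem energy_eq {B : StateSpace p →L[ℝ] StateSpace p}
    (hA : ∀ x z, (x, z) ∈ (opA p).graph ↔ B z = x) (k₁ : ℝ → ℝ) (y : StateSpace p) :
    energy k₁ y = ‖y‖ ^ 2 + ∫ s in (0 : ℝ)..2 * inner ℝ (B y) (tipVector p), k₁ s := by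
  have e : ∀ f : L2 p.L, ∫ x in Ioo 0 p.L, f x ^ 2 = ‖f‖ ^ 2 := fun f => by
    rw [← real_inner_self_eq_norm_sq, ← integral_mul_eq_inner]
    simp only [pow_two]
  rw [inner_apply_tipVector hA, energy, norm_sq_eq, e, e]
  change p.Λ / 2 * ‖D2 y‖ ^ 2 + _ + _ + _ + _ = _
  ring

end Beam

/-! ### Well-posedness and energy decay for the beam -/

theorem theorem3p5 (p : Beam.Params) (k₁ k₂ : ℝ → ℝ)
    (hk₁ : ContDiff ℝ 2 k₁) (hk₂ : ContDiff ℝ 2 k₂)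
    (hk₁_int : ∀ z : ℝ, 0 ≤ ∫ s in (0 : ℝ)..z, k₁ s)
    (hk₂_mono : ∀ z : ℝ, 0 ≤ deriv k₂ z) (hk₂_zero : k₂ 0 = 0)
    (hk₂_quad : ∃ K : ℝ, 0 < K ∧ ∃ δ : ℝ, 0 < δ ∧
      ∀ z : ℝ, z ∈ Set.Ioo (-δ) δ → K * z ^ 2 ≤ |k₂ z|) :
    (∃ S : ℝ → Beam.StateSpace p →L[ℝ] Beam.StateSpace p, Beam.Generates (Beam.opA p) S) ∧
    ∀ S : ℝ → Beam.StateSpace p →L[ℝ] Beam.StateSpace p, Beam.Generates (Beam.opA p) S →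
      ∀ y₀ : Beam.StateSpace p,
        ∃ y : ℝ → Beam.StateSpace p,
          -- `y` is a global mild solution
          Beam.IsMildSolution S (Beam.opN k₁ k₂) y₀ ⊤ y ∧
          -- every mild solution, global or on some `[0, T)`, coincides with `y`
          (∀ (T : EReal) (z : ℝ → Beam.StateSpace p),
            Beam.IsMildSolution S (Beam.opN k₁ k₂) y₀ T z →
              Set.EqOn z y {t : ℝ | 0 ≤ t ∧ (t : EReal) < T}) ∧
          (y₀ ∈ (Beam.opA p).domain →
            Beam.IsClassicalSolution (Beam.opA p) (Beam.opN k₁ k₂) y₀ ⊤ y) ∧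
          AntitoneOn (fun t : ℝ => Beam.energy k₁ (y t)) (Set.Ici 0) ∧
          ∃ C : ℝ, ∀ t : ℝ, 0 ≤ t → ‖y t‖ ≤ C := by
  obtain ⟨B, hB, hi, hA⟩ := Beam.exists_skew_inverse (Beam.opA p) Beam.opA_surjective
    Beam.inner_opA_self
  obtain ⟨U, hU⟩ := Beam.exists_skewGroup hB hi
  refine ⟨⟨U, hU.generates hA⟩, fun S hS y₀ => ?_⟩
  have hSU : ∀ t, 0 ≤ t → S t = U t := fun t ht =>
    hU.eq_of_generates (Beam.dense_range_of_skew hB hi) hA hS ht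
  have h₁ : ContDiff ℝ 1 k₁ := hk₁.of_le one_le_two
  have h₂ : ContDiff ℝ 1 k₂ := hk₂.of_le one_le_two
  have hmono : Monotone k₂ := monotone_of_deriv_nonneg (h₂.differentiable one_ne_zero) hk₂_mono
  have hsign : ∀ x, 0 ≤ x * k₂ x := fun x => by
    rcases le_total 0 x with h | h
    · exact mul_nonneg h (hk₂_zero ▸ hmono h)
    · exact mul_nonneg_of_nonpos_of_nonpos h (hk₂_zero ▸ hmono h)
  obtain ⟨y, hyc, hy, hreg, hanti, hbd⟩ :=
    hU.exists_global_solution hB hi (Beam.tipVector p) h₁ h₂ hk₁_int hsign y₀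
  -- Duhamel's formula uses S only at the times t and t - s ≥ 0, where it equals U.
  have hduh : ∀ (w : ℝ → Beam.StateSpace p) t, 0 ≤ t →
      S t y₀ + ∫ s in (0 : ℝ)..t, S (t - s) (Beam.opN k₁ k₂ (w s)) =
      U t y₀ + ∫ s in (0 : ℝ)..t,
        U (t - s) (Beam.feedback B (Beam.tipVector p) k₁ k₂ (w s)) := fun w t ht => by
    rw [hSU t ht, Beam.opN_eq_feedback hA]
    refine congrArg _ (intervalIntegral.integral_congr fun s hs => ?_)
    rw [Set.uIcc_of_le ht] at hs
    rw [hSU (t - s) (sub_nonneg.2 hs.2)]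
  refine ⟨y, ⟨hyc.continuousOn, fun t ht _ => (hy t ht).trans (hduh y t ht).symm⟩,
    fun T z hz t ht => ?_, fun hy₀ => ?_, ?_, hbd⟩
  · have hsub : Set.Icc 0 t ⊆ {t : ℝ | 0 ≤ t ∧ (t : EReal) < T} := fun s hs =>
      ⟨hs.1, (EReal.coe_le_coe_iff.2 hs.2).trans_lt ht.2⟩
    exact hU.eqOn_of_duhamel
      (fun R => Beam.exists_lipschitzOnWith_feedback B (Beam.tipVector p) h₁ h₂ R)
      (hz.continuousOn.mono hsub)
      (fun s hs => (hz.duhamel s hs.1 (hsub hs).2).trans (hduh z s hs.1))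
      hyc.continuousOn (fun s hs => hy s hs.1) ⟨ht.1, le_rfl⟩
  -- A vector y₀ of D(A) equals B(Ay₀), so it lies in the range of B.
  · obtain ⟨hy0, w, hwc, hw⟩ := hreg
      ⟨Beam.opA p ⟨y₀, hy₀⟩, (hA _ _).1 ((Beam.opA p).mem_graph ⟨y₀, hy₀⟩)⟩
    have hset : {t : ℝ | 0 < t ∧ (t : EReal) < ⊤} = Set.Ioi 0 := by
      ext t
      simp [EReal.coe_lt_top]
    refine ⟨?_, hyc.continuousOn, hy0, fun t ht _ => ?_⟩
    · rw [hset, contDiffOn_one_iff_derivWithin (uniqueDiffOn_Ioi 0)]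
      refine ⟨fun t ht => (hw t ht).1.differentiableAt.differentiableWithinAt,
        hwc.congr fun t ht => ?_⟩
      rw [derivWithin_of_isOpen isOpen_Ioi ht, (hw t ht).1.deriv]
    · obtain ⟨hd, q, hq, hwq⟩ := hw t ht
      obtain ⟨x, hx, hx'⟩ := (LinearPMap.mem_graph_iff _).1 ((hA (y t) q).2 hq.symm)
      simp only at hx hx'
      subst hx'
      refine ⟨hx ▸ x.2, ?_⟩
      have e : (⟨y t, hx ▸ x.2⟩ : (Beam.opA p).domain) = x := Subtype.ext hx.symm
      rw [hd.deriv, hwq, e, Beam.opN_eq_feedback hA]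
  · intro s hs t ht hst
    simp only [Beam.energy_eq hA]
    exact hanti hs ht hst
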